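/- **Setting.** Let $\mathsf X\subset\mathbb R^m$ be compact, let $P$ be a transition kernel on $\mathsf X$, and let $X=\{X_n\}_{n\ge0}$ be a time-homogeneous Markov chain with kernel $P$, arbitrary initial law and filtration $\mathcal F_n=\sigma(X_0,\dots,X_n)$. Let $\beta\in(0,1)$, let $c,c_s:\mathsf X\to\mathbb R$ and $\psi:\mathsf X\to\mathbb R^d$ be measurable, with $c$ and $\psi$ bounded, and put $Q^\theta(x)=\theta^{T}\psi(x)$ for $\theta\in\mathbb R^d$. Assume: 1. (uniform ergodicity) $P$ has a unique invariant probability measure $\pi$, and there are $D<\infty$, $\rho\in(0,1)$ with $|P^n(x,B)-\pi(B)|\le D\rho^n$ for all $n\ge0$, $x\in\mathsf X$ and Borel $B\subset\mathsf X$; 2. the matrix $\Sigma^\psi=\int\psi\psi^T\,d\pi$ is nonsingular; 3. there is $L<\infty$ such that for every $x\in\mathsf X$ the law of $\psi(X_{n+1})$ given $X_n=x$ has a density on $\mathbb R^d$ of the form $\ell(z\mid x)\,p_x(z)$, where $p_x$ is the density of the Gaussian law $\mathcal N(\psi(x),I)$ and $0\le\ell(z\mid x)\le L$; 4. the function $c_s-1$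 lies in the span of $\psi_1,\dots,\psi_d$. With $\mathsf E$ the steady-state expectation ($X_n\sim\pi$, $X_{n+1}\sim P(X_n,\cdot)$) and $\mathbb I$ an indicator, define $$A(\theta)=\mathsf E\big[\psi(X_n)\,\{\beta\,\mathbb I\{Q^\theta(X_{n+1})<c_s(X_{n+1})\}\psi(X_{n+1})-\psi(X_n)\}^{T}\big],$$ $$b^*=\mathsf E[\psi(X_n)c(X_n)],\qquad \bar c_s(\theta)=\mathsf E\big[\psi(X_n)\,\mathbb I\{c_s(X_{n+1})\le Q^\theta(X_{n+1})\}\,c_s(X_{n+1})\big].$$ **Algorithm (Zap-Q).** Let $\alpha_n=1/n$ and $\gamma_n=1/n^{\varrho}$ with $\varrho\in(1/2,1)$. Start from a deterministic $\theta_0\in\mathbb R^d$ and a deterministic negative definite $d\times d$ matrix $\widehat A_0$ (that is, $v^T\widehat A_0v<0$ for $v\ne0$). For $n\ge0$ set $$A_{n+1}=\psi(X_n)\{\beta\,\mathbb I\{Q^{\theta_n}(X_{n+1})<c_s(X_{n+1})\}\psi(X_{n+1})-\psi(X_n)\}^{T},$$ $$d_{n+1}=c(X_n)+\beta\min\big(c_s(X_{n+1}),Q^{\theta_n}(X_{n+1})\big)-Q^{\theta_n}(X_n),$$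 $$\widehat A_{n+1}=\widehat A_n+\gamma_{n+1}[A_{n+1}-\widehat A_n],\qquad \theta_{n+1}=\theta_n-\alpha_{n+1}\widehat A_{n+1}^{\dagger}\psi(X_n)d_{n+1},$$ where $\dagger$ is the Moore–Penrose pseudo-inverse. Assume that $\{\theta_n:n\ge1\}$ is bounded almost surely. **ODE-friendly.** A sequence $\{\mathcal E_k:k\ge1\}$ of random vectors (or matrices) is ODE-friendly if $\mathcal E_k=\Delta_k+\mathcal T_k-\mathcal T_{k-1}+\varepsilon_k$ for $k\ge1$, where $\{\Delta_k\}$ is a martingale difference sequence for $\{\mathcal F_k\}$ such that, for a constant $\bar\sigma^2_\Delta<\infty$, $\mathsf E[\|\Delta_k\|^2\mid\mathcal F_k]\le\bar\sigma^2_\Delta$ a.s. for all $k$; the sequence of random variables $\{\mathcal T_k:k\ge0\}$ is bounded, and so is $\{\varepsilon_k\}$ (each by a deterministic constant, a.s.); and $\sum_{k\ge1}\gamma_k\|\varepsilon_k\|<\infty$ a.s. **Lemma.** Put $$\mathcal E^A_{n+1}=A_{n+1}-A(\theta_n),$$ $$\mathcal E^\theta_{n+1}=\psi(X_n)\big[c(X_n)+\beta\,\mathbb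 I\{c_s(X_{n+1})\le Q^{\theta_n}(X_{n+1})\}c_s(X_{n+1})\big]-b^*-\beta\bar c_s(\theta_n).$$ Then for all $n\ge0$ $$\theta_{n+1}=\theta_n-\alpha_{n+1}\widehat A_{n+1}^{\dagger}\big[A(\theta_n)\theta_n+\beta\bar c_s(\theta_n)+b^*+\mathcal E^A_{n+1}\theta_n+\mathcal E^\theta_{n+1}\big],$$ $$\widehat A_{n+1}=\widehat A_n+\gamma_{n+1}\big[A(\theta_n)-\widehat A_n+\mathcal E^A_{n+1}\big],$$ and the sequences $\{\mathcal E^\theta_n:n\ge1\}$ and $\{\mathcal E^A_n:n\ge1\}$ are ODE-friendly. -/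

import Mathlib

open MeasureTheory ProbabilityTheory Matrix
open scoped ENNReal

noncomputable section

/-! ### The Moore–Penrose pseudo-inverse of a real square matrix -/

/-- The four Penrose equations: `B` is the Moore–Penrose pseudo-inverse of `A`. -/
structure IsMoorePenrose {d : ℕ} (A B : Matrix (Fin d) (Fin d) ℝ) : Prop where
  mul_mul_left : A * B * A = A
  mul_mul_right : B * A * B = B
  symm_left : (A * B)ᵀ = A * B
  symm_right : (B * A)ᵀ = B * A

theorem exists_isMoorePenrose {d : ℕ} (A : Matrix (Fin d) (Fin d) ℝ) :
    ∃ B, IsMoorePenrose A B := by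
  have hH : IsSelfAdjoint (Aᵀ * A) := by
    have h : (Aᴴ * A)ᴴ = Aᴴ * A := Matrix.isHermitian_conjTranspose_mul_self A
    rw [Matrix.conjTranspose_eq_transpose_of_trivial A] at h
    exact h
  have hcont : ∀ f : ℝ → ℝ, ContinuousOn f (spectrum ℝ (Aᵀ * A)) := fun f =>
    (Matrix.finite_real_spectrum (A := Aᵀ * A)).continuousOn f
  obtain ⟨G, hG⟩ : ∃ G, G = cfc (fun x : ℝ => x⁻¹) (Aᵀ * A) := ⟨_, rfl⟩
  have hGs : Gᵀ = G := by
    have h : IsSelfAdjoint G := by rw [hG]; exact cfc_predicate _ _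
    have h' : Gᴴ = G := h
    simpa [Matrix.conjTranspose_eq_transpose_of_trivial] using h'
  have hid : cfc (fun x : ℝ => x) (Aᵀ * A) = Aᵀ * A := cfc_id' ℝ (Aᵀ * A)
  have hGH : G * (Aᵀ * A) = cfc (fun x : ℝ => x⁻¹ * x) (Aᵀ * A) := by
    rw [cfc_mul _ _ _ (hcont _) (hcont _), hid, hG]
  have hHG : (Aᵀ * A) * G = cfc (fun x : ℝ => x⁻¹ * x) (Aᵀ * A) := by
    have : (fun x : ℝ => x⁻¹ * x) = fun x : ℝ => x * x⁻¹ := by ext x; ring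
    rw [this, cfc_mul _ _ _ (hcont _) (hcont _), hid, hG]
  have hHGH : (Aᵀ * A) * G * (Aᵀ * A) = Aᵀ * A := by
    have h : cfc (fun x : ℝ => x⁻¹ * x * x) (Aᵀ * A) = Aᵀ * A := by
      have : (fun x : ℝ => x⁻¹ * x * x) = fun x : ℝ => x := by
        ext x; by_cases hx : x = 0 <;> simp [hx]
      rw [this, hid]
    rw [hHG]
    refine Eq.trans ?_ h
    rw [cfc_mul (fun x : ℝ => x⁻¹ * x) (fun x : ℝ => x) _ (hcont _) (hcont _), hid]
  have hGHG : G * (Aᵀ * A) * G = G := by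
    have h : cfc (fun x : ℝ => x⁻¹ * x * x⁻¹) (Aᵀ * A) = G := by
      have : (fun x : ℝ => x⁻¹ * x * x⁻¹) = fun x : ℝ => x⁻¹ := by
        ext x; by_cases hx : x = 0 <;> simp [hx]
      rw [this, hG]
    rw [hGH]
    refine Eq.trans ?_ h
    rw [cfc_mul (fun x : ℝ => x⁻¹ * x) (fun x : ℝ => x⁻¹) _ (hcont _) (hcont _), ← hG]
  have hcomm : G * (Aᵀ * A) = (Aᵀ * A) * G := hGH.trans hHG.symm
  have key : A * G * Aᵀ * A = A := by
    have h0 : (A * (G * (Aᵀ * A) - 1))ᵀ * (A * (G * (Aᵀ * A) - 1)) = 0 := by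
      have e : Aᵀ * (A * (G * (Aᵀ * A) - 1)) = 0 := by
        rw [Matrix.mul_sub, Matrix.mul_sub, Matrix.mul_one]
        simp only [Matrix.mul_assoc] at hHGH ⊢
        rw [hHGH, sub_self]
      rw [Matrix.transpose_mul, Matrix.mul_assoc, e, Matrix.mul_zero]
    have h1 : A * (G * (Aᵀ * A) - 1) = 0 := by
      apply Matrix.conjTranspose_mul_self_eq_zero.mp
      rw [Matrix.conjTranspose_eq_transpose_of_trivial]
      exact h0
    rw [Matrix.mul_sub, Matrix.mul_one, sub_eq_zero] at h1
    simpa [Matrix.mul_assoc] using h1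
  refine ⟨G * Aᵀ, ?_, ?_, ?_, ?_⟩
  · simpa [Matrix.mul_assoc] using key
  · have : G * Aᵀ * A * (G * Aᵀ) = G * (Aᵀ * A) * G * Aᵀ := by simp only [Matrix.mul_assoc]
    rw [this, hGHG]
  · simp [Matrix.transpose_mul, hGs, Matrix.mul_assoc]
  · rw [Matrix.mul_assoc, Matrix.transpose_mul, hGs, Matrix.transpose_mul,
      Matrix.transpose_transpose, hcomm]

theorem IsMoorePenrose.unique {d : ℕ} {A B C : Matrix (Fin d) (Fin d) ℝ}
    (hB : IsMoorePenrose A B) (hC : IsMoorePenrose A C) : B = C := by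
  have hAB : A * B = A * C := by
    calc A * B = (A * B)ᵀ := hB.symm_left.symm
      _ = (A * C * A * B)ᵀ := by rw [hC.mul_mul_left]
      _ = (A * B)ᵀ * (A * C)ᵀ := by rw [← Matrix.transpose_mul]; simp only [Matrix.mul_assoc]
      _ = A * B * A * C := by rw [hB.symm_left, hC.symm_left]; simp only [Matrix.mul_assoc]
      _ = A * C := by rw [hB.mul_mul_left]
  have hBA : B * A = C * A := by
    calc B * A = (B * A)ᵀ := hB.symm_right.symm
      _ = (B * (A * C * A))ᵀ := by rw [hC.mul_mul_left]
      _ = (C * A)ᵀ * (B * A)ᵀ := by rw [← Matrix.transpose_mul]; simp only [Matrix.mul_assoc]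
      _ = C * (A * B * A) := by rw [hB.symm_right, hC.symm_right]; simp only [Matrix.mul_assoc]
      _ = C * A := by rw [hB.mul_mul_left]
  calc B = B * A * B := hB.mul_mul_right.symm
    _ = C * A * B := by rw [hBA]
    _ = C * (A * B) := Matrix.mul_assoc _ _ _
    _ = C * A * C := by rw [hAB, Matrix.mul_assoc]
    _ = C := hC.mul_mul_right

/-- The Moore–Penrose pseudo-inverse `A†`. -/
def pinv {d : ℕ} (A : Matrix (Fin d) (Fin d) ℝ) : Matrix (Fin d) (Fin d) ℝ :=
  Classical.choose (exists_isMoorePenrose A)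

theorem pinv_spec {d : ℕ} (A : Matrix (Fin d) (Fin d) ℝ) : IsMoorePenrose A (pinv A) :=
  Classical.choose_spec (exists_isMoorePenrose A)

end

/- A norm on matrices: the largest absolute value of an entry. Vectors `Fin d → ℝ` carry the maximum
norm. Norms occur below only in statements (boundedness, summability) that do not depend on the
choice of a norm on a finite-dimensional space. -/
attribute [local instance] Matrix.normedAddCommGroup Matrix.normedSpace

noncomputable section

/-! ### ODE-friendly sequences -/

/-- The sequence `(𝓔 k)`, `k ≥ 1`, of random vectors is ODE-friendly with respect to the filtration
`ℱ` and the step sizes `γ`: it is the sum of a martingale difference `Δ k`, a telescoping term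
`T k - T (k - 1)` and a remainder `ε k`. (The entries with index `0` of `𝓔`, `Δ`, `ε` and `γ` are
not used.) -/
def ODEFriendly {Ω E : Type*} [mΩ : MeasurableSpace Ω] [NormedAddCommGroup E] [NormedSpace ℝ E]
    [CompleteSpace E] (Pr : Measure Ω) (ℱ : Filtration ℕ mΩ) (γ : ℕ → ℝ) (𝓔 : ℕ → Ω → E) : Prop :=
  ∃ Δ T ε : ℕ → Ω → E,
    (∀ k, 1 ≤ k → ∀ ω, 𝓔 k ω = Δ k ω + (T k ω - T (k - 1) ω) + ε k ω) ∧
    -- the martingale difference sequence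
    (∀ k, 1 ≤ k → StronglyMeasurable[ℱ k] (Δ k) ∧ Integrable (Δ k) Pr ∧
      Pr[Δ k | ℱ (k - 1)] =ᵐ[Pr] 0) ∧
    (∃ σ : ℝ, ∀ k, 1 ≤ k → Integrable (fun ω => ‖Δ k ω‖ ^ 2) Pr ∧
      ∀ᵐ ω ∂Pr, (Pr[fun ω' => ‖Δ k ω'‖ ^ 2 | ℱ k]) ω ≤ σ ^ 2) ∧
    -- the bounded sequence that is telescoped
    (∀ k, StronglyMeasurable (T k)) ∧
    (∃ B : ℝ, ∀ k, ∀ᵐ ω ∂Pr, ‖T k ω‖ ≤ B) ∧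
    -- the bounded and `γ`-summable remainder
    (∀ k, 1 ≤ k → StronglyMeasurable (ε k)) ∧
    (∃ B : ℝ, ∀ k, 1 ≤ k → ∀ᵐ ω ∂Pr, ‖ε k ω‖ ≤ B) ∧
    (∀ᵐ ω ∂Pr, Summable fun k : ℕ => γ (k + 1) * ‖ε (k + 1) ω‖)

/-! ### Optimal stopping with linear function approximation -/

/-- The data of a discounted optimal stopping problem with basis functions. -/
structure StoppingProblem (m d : ℕ) where
  /-- the state space -/
  S : Set (Fin m → ℝ)
  /-- the transition kernel -/
  P : Kernel S S
  /-- the discount factor -/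
  β : ℝ
  /-- the per-stage cost -/
  c : S → ℝ
  /-- the terminal cost -/
  cs : S → ℝ
  /-- the vector of basis functions -/
  ψ : S → Fin d → ℝ

namespace StoppingProblem

variable {m d : ℕ} (M : StoppingProblem m d)

/-- Compact state space, Markov kernel, discount factor in `(0, 1)`, measurable cost functions and
basis functions, of which the per-stage cost and the basis are bounded. -/
structure IsRegular : Prop where
  compact : IsCompact M.S
  markov : IsMarkovKernel M.P
  beta_pos : 0 < M.β
  beta_lt_one : M.β < 1
  measurable_c : Measurable M.c
  measurable_cs : Measurable M.cs
  measurable_psi : Measurable M.ψ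
  bounded_c : ∃ B : ℝ, ∀ x, |M.c x| ≤ B
  bounded_psi : ∃ B : ℝ, ∀ x, ‖M.ψ x‖ ≤ B

/-- Uniform ergodicity with unique invariant probability measure `π`. -/
structure UniformlyErgodic (π : Measure M.S) : Prop where
  prob : IsProbabilityMeasure π
  invariant : M.P.Invariant π
  unique : ∀ ν : Measure M.S, IsProbabilityMeasure ν → M.P.Invariant ν → ν = π
  geometric : ∃ D ρ : ℝ, 0 < ρ ∧ ρ < 1 ∧ ∀ (x : M.S) (A : Set M.S), MeasurableSet A →
    ∀ n : ℕ, |((M.P ^ n) x).real A - π.real A| ≤ D * ρ ^ n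

/-- The covariance matrix `Σ` of the basis: `Σ i j = ⟨ψ i, ψ j⟩` in `L²(π)`. -/
def covariance (π : Measure M.S) : Matrix (Fin d) (Fin d) ℝ :=
  Matrix.of fun i j => ∫ x, M.ψ x i * M.ψ x j ∂π

/-- The density of the Gaussian distribution `N(μ, I)` on `ℝ^d`. -/
def gaussianDensity (μ z : Fin d → ℝ) : ℝ :=
  (√(2 * Real.pi))⁻¹ ^ d * Real.exp (-((z - μ) ⬝ᵥ (z - μ)) / 2)

/-- The law of `ψ(X_{n+1})` given `X_n = x` has a Lebesgue density, whose likelihood ratio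
`ℓ(z | x)` with respect to the density of `N(ψ(x), I)` is bounded uniformly in `x` and `z`. -/
def HasBoundedLikelihoodRatio : Prop :=
  ∃ (ℓ : M.S → (Fin d → ℝ) → ℝ) (L : ℝ), ∀ x, Measurable (ℓ x) ∧
    (∀ z, 0 ≤ ℓ x z ∧ ℓ x z ≤ L) ∧
    (M.P x).map M.ψ =
      volume.withDensity fun z => ENNReal.ofReal (ℓ x z * gaussianDensity (M.ψ x) z)

/-- The function `c_s - 1` lies in the linear span of the basis functions. -/
def TerminalCostInSpan : Prop :=
  (fun x => M.cs x - 1) ∈ Submodule.span ℝ (Set.range fun (i : Fin d) (x : M.S) => M.ψ x i)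

/-- `Q^θ(x) = θᵀ ψ(x)`. -/
def Q (θ : Fin d → ℝ) (x : M.S) : ℝ := θ ⬝ᵥ M.ψ x

open Classical in
/-- The factor `I{Q^θ(x) < c_s(x)}` of the operator `𝒮_θ`. -/
def contInd (θ : Fin d → ℝ) (x : M.S) : ℝ := if M.Q θ x < M.cs x then 1 else 0

open Classical in
/-- The factor `I{c_s(x) ≤ Q^θ(x)}` of the operator `𝒮_θ^c`. -/
def stopInd (θ : Fin d → ℝ) (x : M.S) : ℝ := if M.cs x ≤ M.Q θ x then 1 else 0

/-- `ψ(x) [β 𝒮_θ ψ(y) - ψ(x)]ᵀ`. -/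
def sampleA (θ : Fin d → ℝ) (x y : M.S) : Matrix (Fin d) (Fin d) ℝ :=
  vecMulVec (M.ψ x) ((M.β * M.contInd θ y) • M.ψ y - M.ψ x)

/-- `A(θ) = E[ψ(X_n) β 𝒮_θ ψᵀ(X_{n+1}) - ψ(X_n) ψᵀ(X_n)]`, expectation in steady state. -/
def meanA (π : Measure M.S) (θ : Fin d → ℝ) : Matrix (Fin d) (Fin d) ℝ :=
  Matrix.of fun i j => ∫ p, M.sampleA θ p.1 p.2 i j ∂(π ⊗ₘ M.P)

/-- `b* = E[ψ(X_n) c(X_n)]`, expectation in steady state. -/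
def bStar (π : Measure M.S) : Fin d → ℝ := fun i => ∫ x, M.ψ x i * M.c x ∂π

/-- `c̄_s(θ) = E[ψ(X_n) 𝒮_θ^c c_s(X_{n+1})]`, expectation in steady state. -/
def meanCs (π : Measure M.S) (θ : Fin d → ℝ) : Fin d → ℝ :=
  fun i => ∫ p, M.ψ p.1 i * (M.stopInd θ p.2 * M.cs p.2) ∂(π ⊗ₘ M.P)

/-- The temporal difference for the parameter `θ` and the transition from `x` to `y`. -/
def tempDiff (θ : Fin d → ℝ) (x y : M.S) : ℝ :=
  M.c x + M.β * min (M.cs y) (M.Q θ y) - M.Q θ x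

/-! ### The Markov chain and the Zap-Q algorithm -/

/-- The filtration `ℱ_n = σ(X_0, …, X_n)`. -/
def chainFiltration {M : StoppingProblem m d} {Ω : Type*} [mΩ : MeasurableSpace Ω]
    (X : ℕ → Ω → M.S) (hX : ∀ n, Measurable (X n)) : Filtration ℕ mΩ :=
  Filtration.natural X fun n => (hX n).stronglyMeasurable

/-- The Markov property of `X` with transition kernel `P`. The initial law is arbitrary. -/
def IsMarkovChain {Ω : Type*} [MeasurableSpace Ω] (Pr : Measure Ω) (X : ℕ → Ω → M.S)
    (hX : ∀ n, Measurable (X n)) : Prop :=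
  ∀ (h : M.S → ℝ), Measurable h → (∃ B : ℝ, ∀ x, |h x| ≤ B) → ∀ n,
    Pr[fun ω => h (X (n + 1) ω) | chainFiltration X hX n] =ᵐ[Pr] fun ω => ∫ y, h y ∂(M.P (X n ω))

/-- `α_n = 1 / n`. -/
def alphaStep (n : ℕ) : ℝ := 1 / (n : ℝ)

/-- `γ_n = 1 / n ^ ϱ`. -/
def gammaStep (ϱ : ℝ) (n : ℕ) : ℝ := 1 / (n : ℝ) ^ ϱ

/-- The pair `(θ_n, Â_n)` produced by Zap-Q along the trajectory `x`:
`Â_{n+1} = Â_n + γ_{n+1} [A_{n+1} - Â_n]` and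
`θ_{n+1} = θ_n - α_{n+1} Â_{n+1}† ψ(x_n) d_{n+1}`. -/
def zapIter (ϱ : ℝ) (θ₀ : Fin d → ℝ) (A₀ : Matrix (Fin d) (Fin d) ℝ) (x : ℕ → M.S) :
    ℕ → (Fin d → ℝ) × Matrix (Fin d) (Fin d) ℝ
  | 0 => (θ₀, A₀)
  | n + 1 =>
    let θ := (zapIter ϱ θ₀ A₀ x n).1
    let A := (zapIter ϱ θ₀ A₀ x n).2
    let A' := A + gammaStep ϱ (n + 1) • (M.sampleA θ (x n) (x (n + 1)) - A)
    (θ - alphaStep (n + 1) • (pinv A' *ᵥ (M.tempDiff θ (x n) (x (n + 1)) • M.ψ (x n))), A')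

/-- The parameter sequence `θ_n` of the Zap-Q algorithm. -/
def zapTheta {Ω : Type*} (ϱ : ℝ) (θ₀ : Fin d → ℝ) (A₀ : Matrix (Fin d) (Fin d) ℝ)
    (X : ℕ → Ω → M.S) (n : ℕ) (ω : Ω) : Fin d → ℝ :=
  (M.zapIter ϱ θ₀ A₀ (fun k => X k ω) n).1

/-- The matrix sequence `Â_n` of the Zap-Q algorithm. -/
def zapA {Ω : Type*} (ϱ : ℝ) (θ₀ : Fin d → ℝ) (A₀ : Matrix (Fin d) (Fin d) ℝ)
    (X : ℕ → Ω → M.S) (n : ℕ) (ω : Ω) : Matrix (Fin d) (Fin d) ℝ :=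
  (M.zapIter ϱ θ₀ A₀ (fun k => X k ω) n).2

/-- `𝓔^A_{n+1} = A_{n+1} - A(θ_n)` for a parameter sequence `θ` (index `0` is not used). -/
def errA {Ω : Type*} (π : Measure M.S) (X : ℕ → Ω → M.S) (θ : ℕ → Ω → Fin d → ℝ) :
    ℕ → Ω → Matrix (Fin d) (Fin d) ℝ
  | 0, _ => 0
  | n + 1, ω => M.sampleA (θ n ω) (X n ω) (X (n + 1) ω) - M.meanA π (θ n ω)

/-- `𝓔^θ_{n+1} = ψ(X_n) [c(X_n) + β 𝒮_{θ_n}^c c_s(X_{n+1})] - b* - β c̄_s(θ_n)` for a parameter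
sequence `θ` (index `0` is not used). -/
def errTheta {Ω : Type*} (π : Measure M.S) (X : ℕ → Ω → M.S) (θ : ℕ → Ω → Fin d → ℝ) :
    ℕ → Ω → Fin d → ℝ
  | 0, _ => 0
  | n + 1, ω =>
    (M.c (X n ω) + M.β * (M.stopInd (θ n ω) (X (n + 1) ω) * M.cs (X (n + 1) ω))) • M.ψ (X n ω)
      - M.bStar π - M.β • M.meanCs π (θ n ω)

end StoppingProblem

end

/-!
Both errors have the form `h(θₙ, Xₙ, Xₙ₊₁) - ∫ h(θₙ, ·) d(π ⊗ P)` with `h` bounded. Put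
`g_θ(x) = ∫ h(θ, x, y) P(x, dy)` and let `ĝ_θ = ∑ₖ (Pᵏ g_θ - π g_θ)` be the solution of Poisson's
equation `P ĝ_θ = ĝ_θ - (g_θ - π g_θ)`, which is bounded by uniform ergodicity (`poissonSol`).
The error is then the sum of the martingale difference
`h(θₙ, Xₙ, Xₙ₊₁) + ĝ_{θₙ}(Xₙ₊₁) - ĝ_{θₙ}(Xₙ) - π g_{θₙ}`, the telescoping term with
`Tₙ = -ĝ_{θₙ}(Xₙ)`, and the remainder `ĝ_{θₙ₊₁}(Xₙ₊₁) - ĝ_{θₙ}(Xₙ₊₁)`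
(`MarkovRel.odeFriendly`). Only the summability of the remainder needs more than boundedness, and
it rests on two facts.

*Lipschitz continuity of `θ ↦ g_θ`, uniformly in the state.* The parameter enters through the
indicator of `Q^θ < c_s`. Since `c_s - 1` lies in the span of the basis, this is the event that
`ψ(y)` lies on one side of the hyperplane `(θ - w) ⬝ z = 1`. Two parameters disagree only on a slab
of width of order `‖θ - θ'‖`, whose probability is of the same order because the law of `ψ(y)` has
bounded support and bounded density (`volume_slab_le`,
`HasBoundedLikelihoodRatio.exists_lipschitz`).

*Slow variation of `θₙ`.* As `∑ γₙ αₙ < ∞`, it suffices that the gains `Âₙ†` are bounded along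
almost every trajectory. By Young's inequality the quadratic form of each sample matrix is at most
that of `-(1 - β/2) ψ(x) ψ(x)ᵀ + (β/2) ψ(y) ψ(y)ᵀ`, which does not involve `θ`. The stochastic
approximation averages of these matrices converge to `-(1 - β) Σ`, by the same noise decomposition
with a trivial parameter together with martingale convergence and Abel summation
(`ODEFriendly.ae_exists_tendsto_sum`). Hence `Âₙ` is eventually uniformly negative definite
(`ae_exists_zapA_coercive`), with no circular use of the result for `𝓔^A`.

The iterates are adapted because the pseudo-inverse is a Borel map, by the Lusin–Souslin theorem
(`measurable_pinv`).
-/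

noncomputable section

open Filter Topology

/-! ### Poisson's equation for a uniformly ergodic kernel -/

section Poisson

theorem integrable_of_forall_abs_le {α : Type*} [MeasurableSpace α] {μ : Measure α}
    [IsFiniteMeasure μ] {f : α → ℝ} (hf : Measurable f) {B : ℝ} (hB : ∀ x, |f x| ≤ B) :
    Integrable f μ :=
  Integrable.of_bound hf.aestronglyMeasurable B (ae_of_all _ hB)

theorem abs_integral_le_of_forall_abs_le {α : Type*} [MeasurableSpace α] {μ : Measure α}
    [IsProbabilityMeasure μ] {f : α → ℝ} {B : ℝ} (hB : ∀ x, |f x| ≤ B) :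
    |∫ x, f x ∂μ| ≤ B := by
  simpa using norm_integral_le_of_norm_le_const (μ := μ) (f := f) (C := B) (ae_of_all _ hB)

/-- Setwise closeness of two probability measures bounds the difference of integrals of a bounded
function, by the layer cake formula applied to `f + B ≥ 0`. -/
theorem abs_integral_sub_integral_le {α : Type*} [MeasurableSpace α] {μ ν : Measure α}
    [IsProbabilityMeasure μ] [IsProbabilityMeasure ν] {e : ℝ}
    (h : ∀ A, MeasurableSet A → |μ.real A - ν.real A| ≤ e)
    {f : α → ℝ} (hf : Measurable f) {B : ℝ} (hB : ∀ x, |f x| ≤ B) :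
    |∫ x, f x ∂μ - ∫ x, f x ∂ν| ≤ 2 * B * e := by
  have hB0 : 0 ≤ B := by
    obtain ⟨x⟩ : Nonempty α := nonempty_of_isProbabilityMeasure μ
    exact (abs_nonneg _).trans (hB x)
  have key : ∀ (η : Measure α) [IsProbabilityMeasure η], ∫ x, f x ∂η + B =
      ∫ t in Set.Ioc 0 (2 * B), η.real {a | t ≤ f a + B} := by
    intro η _
    have hi : Integrable f η := integrable_of_forall_abs_le hf hB
    rw [← Integrable.integral_eq_integral_Ioc_meas_le (f := fun a => f a + B)
      (hi.add (integrable_const B)), integral_add hi (integrable_const B)]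
    · simp
    · exact ae_of_all _ fun x => by have := neg_le_of_abs_le (hB x); simp; linarith
    · exact ae_of_all _ fun x => by have := le_of_abs_le (hB x); simp; linarith
  have hm : ∀ (η : Measure α) [IsProbabilityMeasure η],
      IntegrableOn (fun t => η.real {a | t ≤ f a + B}) (Set.Ioc 0 (2 * B)) := by
    intro η _
    have ha : Antitone fun t => η.real {a | t ≤ f a + B} := fun s t hst =>
      measureReal_mono fun a ha => hst.trans ha
    exact (ha.antitoneOn (Set.Icc 0 (2 * B))).integrableOn_isCompact isCompact_Icc |>.mono_set
      Set.Ioc_subset_Icc_self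
  have e1 : ∫ x, f x ∂μ - ∫ x, f x ∂ν = ∫ t in Set.Ioc 0 (2 * B),
      (μ.real {a | t ≤ f a + B} - ν.real {a | t ≤ f a + B}) := by
    rw [integral_sub (hm μ) (hm ν), ← key μ, ← key ν]; ring
  rw [e1, ← Real.norm_eq_abs]
  refine (norm_setIntegral_le_of_norm_le_const (μ := (volume : Measure ℝ))
    (C := e) measure_Ioc_lt_top fun t _ => ?_).trans ?_
  · exact h _ (measurableSet_le measurable_const (hf.add_const B))
  · rw [Real.volume_real_Ioc_of_le (by linarith)]; linarith

variable {S : Type*} [MeasurableSpace S]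

/-- The solution `∑ₖ (Pᵏ g - π g)` of Poisson's equation with forcing function `g`. -/
def poissonSol (P : Kernel S S) (π : Measure S) (g : S → ℝ) (x : S) : ℝ :=
  ∑' k : ℕ, (∫ y, g y ∂(P ^ k) x - ∫ y, g y ∂π)

/-- Geometric ergodicity, uniformly in the initial state. -/
def GeomErgodic (P : Kernel S S) (π : Measure S) (D ρ : ℝ) : Prop :=
  0 < ρ ∧ ρ < 1 ∧ ∀ (x : S) (A : Set S), MeasurableSet A →
    ∀ n : ℕ, |((P ^ n) x).real A - π.real A| ≤ D * ρ ^ n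

instance isMarkovKernel_pow (P : Kernel S S) [IsMarkovKernel P] (n : ℕ) :
    IsMarkovKernel (P ^ n) := by
  induction n with
  | zero => exact inferInstanceAs (IsMarkovKernel Kernel.id)
  | succ n ih => exact inferInstanceAs (IsMarkovKernel ((P ^ n) ∘ₖ P))

section Solution

theorem GeomErgodic.summable_bound {P : Kernel S S} {π : Measure S} {D ρ : ℝ}
    (hP : GeomErgodic P π D ρ) (B : ℝ) :
    Summable fun k : ℕ => 2 * B * (D * ρ ^ k) :=
  ((summable_geometric_of_lt_one hP.1.le hP.2.1).mul_left D).mul_left _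

variable {P : Kernel S S} [IsMarkovKernel P] {π : Measure S} [IsProbabilityMeasure π] {D ρ : ℝ}

theorem GeomErgodic.abs_term_le (hP : GeomErgodic P π D ρ) {g : S → ℝ} (hg : Measurable g) {B : ℝ}
    (hB : ∀ x, |g x| ≤ B) (x : S) (k : ℕ) :
    |∫ y, g y ∂(P ^ k) x - ∫ y, g y ∂π| ≤ 2 * B * (D * ρ ^ k) :=
  abs_integral_sub_integral_le (fun A hA => hP.2.2 x A hA k) hg hB

theorem GeomErgodic.summable_term (hP : GeomErgodic P π D ρ) {g : S → ℝ} (hg : Measurable g)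
    {B : ℝ} (hB : ∀ x, |g x| ≤ B) (x : S) :
    Summable fun k : ℕ => (∫ y, g y ∂(P ^ k) x - ∫ y, g y ∂π) :=
  (hP.summable_bound B).of_norm_bounded (hP.abs_term_le hg hB x)

theorem GeomErgodic.abs_poissonSol_le (hP : GeomErgodic P π D ρ) {g : S → ℝ} (hg : Measurable g)
    {B : ℝ} (hB : ∀ x, |g x| ≤ B) (x : S) :
    |poissonSol P π g x| ≤ 2 * D / (1 - ρ) * B := by
  refine (tsum_of_norm_bounded (f := fun k : ℕ => ∫ y, g y ∂(P ^ k) x - ∫ y, g y ∂π)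
    (hP.summable_bound B).hasSum (hP.abs_term_le hg hB x)).trans ?_
  rw [tsum_mul_left, tsum_mul_left, tsum_geometric_of_lt_one hP.1.le hP.2.1]
  apply le_of_eq
  ring

theorem GeomErgodic.poissonSol_sub (hP : GeomErgodic P π D ρ) {g g' : S → ℝ} (hg : Measurable g)
    (hg' : Measurable g') {B B' : ℝ} (hB : ∀ x, |g x| ≤ B) (hB' : ∀ x, |g' x| ≤ B') (x : S) :
    poissonSol P π (fun y => g y - g' y) x = poissonSol P π g x - poissonSol P π g' x := by
  unfold poissonSol
  rw [← (hP.summable_term hg hB x).tsum_sub (hP.summable_term hg' hB' x)]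
  congr 1
  ext k
  rw [integral_sub, integral_sub]
  · ring
  all_goals first
    | exact integrable_of_forall_abs_le hg hB
    | exact integrable_of_forall_abs_le hg' hB'

theorem measurable_poissonSol_uncurry (hP : GeomErgodic P π D ρ) {Θ : Type*} [MeasurableSpace Θ]
    {g : Θ → S → ℝ} (hg : Measurable (Function.uncurry g)) {B : ℝ} (hB : ∀ θ x, |g θ x| ≤ B) :
    Measurable fun p : Θ × S => poissonSol P π (g p.1) p.2 := by
  have hgθ : ∀ θ, Measurable (g θ) := fun θ => hg.comp measurable_prodMk_left
  have hterm : ∀ k : ℕ, Measurable fun p : Θ × S =>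
      (∫ y, g p.1 y ∂(P ^ k) p.2 - ∫ y, g p.1 y ∂π) := by
    intro k
    refine Measurable.sub ?_ ?_
    · have : StronglyMeasurable fun q : (Θ × S) × S => g q.1.1 q.2 :=
        (hg.comp ((measurable_fst.comp measurable_fst).prodMk measurable_snd)).stronglyMeasurable
      exact (this.integral_kernel_prod_right' (κ := Kernel.prodMkLeft Θ (P ^ k))).measurable
    · have : StronglyMeasurable fun q : (Θ × S) × S => g q.1.1 q.2 :=
        (hg.comp ((measurable_fst.comp measurable_fst).prodMk measurable_snd)).stronglyMeasurable
      exact (this.integral_kernel_prod_right' (κ := Kernel.const (Θ × S) π)).measurable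
  refine measurable_of_tendsto_metrizable
    (f := fun n p => ∑ k ∈ Finset.range n, (∫ y, g p.1 y ∂(P ^ k) p.2 - ∫ y, g p.1 y ∂π))
    (fun n => Finset.measurable_fun_sum _ fun k _ => hterm k) ?_
  rw [tendsto_pi_nhds]
  exact fun p => (hP.summable_term (hgθ p.1) (hB p.1) p.2).hasSum.tendsto_sum_nat

/-- Poisson's equation `P ĝ = ĝ - (g - π g)`. -/
theorem GeomErgodic.integral_poissonSol (hP : GeomErgodic P π D ρ) {g : S → ℝ} (hg : Measurable g)
    {B : ℝ} (hB : ∀ x, |g x| ≤ B) (x : S) :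
    ∫ y, poissonSol P π g y ∂P x = poissonSol P π g x - (g x - ∫ y, g y ∂π) := by
  have hmeas : ∀ k : ℕ, Measurable fun y => (∫ z, g z ∂(P ^ k) y - ∫ z, g z ∂π) := fun k =>
    (hg.stronglyMeasurable.integral_kernel (κ := P ^ k)).measurable.sub_const _
  have hint : ∀ k : ℕ, Integrable (fun y => (∫ z, g z ∂(P ^ k) y - ∫ z, g z ∂π)) (P x) := fun k =>
    integrable_of_forall_abs_le (hmeas k) (hP.abs_term_le hg hB · k)
  have hstep : ∀ k : ℕ, ∫ y, (∫ z, g z ∂(P ^ k) y - ∫ z, g z ∂π) ∂P x =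
      ∫ z, g z ∂(P ^ (k + 1)) x - ∫ z, g z ∂π := by
    intro k
    have hk : P ^ (k + 1) = (P ^ k) ∘ₖ P := pow_succ P k
    rw [hk, Kernel.integral_comp (integrable_of_forall_abs_le hg hB), integral_sub]
    · simp
    · exact integrable_of_forall_abs_le (hg.stronglyMeasurable.integral_kernel).measurable
        (fun y => abs_integral_le_of_forall_abs_le hB)
    · exact integrable_const _
  have hsum : Summable fun k : ℕ => ∫ y, ‖∫ z, g z ∂(P ^ k) y - ∫ z, g z ∂π‖ ∂P x := by
    refine (hP.summable_bound B).of_norm_bounded fun k => ?_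
    exact abs_integral_le_of_forall_abs_le fun y => by
      rw [Real.norm_eq_abs, abs_abs]; exact hP.abs_term_le hg hB y k
  have h1 := (hasSum_integral_of_summable_integral_norm hint hsum).tsum_eq
  have h2 := (hP.summable_term hg hB x).tsum_eq_zero_add
  have h0 : (P ^ 0) = Kernel.id := rfl
  simp only [hstep] at h1
  unfold poissonSol
  rw [← h1, h2, h0, Kernel.id_apply, integral_dirac' _ _ hg.stronglyMeasurable]
  ring

end Solution

end Poisson

/-! ### The Markov property for functions of the past and the next state -/

section MarkovProperty

variable {S : Type*} [MeasurableSpace S] {Ω : Type*} [mΩ : MeasurableSpace Ω]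

/-- `X` is adapted to `ℱ` and has the Markov property with kernel `P` relative to `ℱ`, expressed
through the conditional probabilities of sets. -/
structure MarkovRel (Pr : Measure Ω) (ℱ : Filtration ℕ mΩ) (P : Kernel S S)
    (X : ℕ → Ω → S) : Prop where
  adapted : ∀ n, Measurable[ℱ n] (X n)
  condProb : ∀ V : Set S, MeasurableSet V → ∀ n,
    Pr[fun ω => V.indicator (fun _ => (1 : ℝ)) (X (n + 1) ω) | ℱ n]
      =ᵐ[Pr] fun ω => (P (X n ω)).real V

theorem MarkovRel.measurable {Pr : Measure Ω} {ℱ : Filtration ℕ mΩ} {P : Kernel S S}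
    {X : ℕ → Ω → S} (hX : MarkovRel Pr ℱ P X) (n : ℕ) : Measurable (X n) :=
  (hX.adapted n).mono (ℱ.le n) le_rfl

variable {Pr : Measure Ω} [IsProbabilityMeasure Pr] {ℱ : Filtration ℕ mΩ} {P : Kernel S S}
  [IsMarkovKernel P] {X : ℕ → Ω → S}

/-- On an event of the past, the joint law of the past and the next state is a
composition-product. -/
theorem MarkovRel.map_restrict_eq_compProd (hX : MarkovRel Pr ℱ P X) {α : Type*}
    [MeasurableSpace α] {n : ℕ} {Z : Ω → α} (hZ : Measurable[ℱ n] Z) {A : Set Ω}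
    (hA : MeasurableSet[ℱ n] A) :
    (Pr.restrict A).map (fun ω => ((Z ω, X n ω), X (n + 1) ω)) =
      ((Pr.restrict A).map fun ω => (Z ω, X n ω)) ⊗ₘ (Kernel.prodMkLeft α P) := by
  have hW : Measurable[ℱ n] fun ω => (Z ω, X n ω) := hZ.prodMk (hX.adapted n)
  have hW' : Measurable fun ω => (Z ω, X n ω) := hW.mono (ℱ.le n) le_rfl
  refine Measure.ext_prod fun {U V} hU hV => ?_
  have hAU : MeasurableSet[ℱ n] ((fun ω => (Z ω, X n ω)) ⁻¹' U ∩ A) := (hW hU).inter hA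
  have hAU' := ℱ.le n _ hAU
  have hPV : Measurable fun ω => (P (X n ω)) V :=
    (P.measurable_coe hV).comp (hX.measurable n)
  rw [Measure.compProd_apply_prod hU hV, setLIntegral_map hU
    ((Kernel.prodMkLeft α P).measurable_coe hV) hW', Measure.restrict_restrict (hW' hU),
    Measure.map_apply (hW'.prodMk (hX.measurable _)) (hU.prod hV),
    Measure.restrict_apply ((hW'.prodMk (hX.measurable _)) (hU.prod hV))]
  have e1 : (∫⁻ ω in (fun ω => (Z ω, X n ω)) ⁻¹' U ∩ A, (P (X n ω)) V ∂Pr) =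
      ENNReal.ofReal (∫ ω in (fun ω => (Z ω, X n ω)) ⁻¹' U ∩ A, (P (X n ω)).real V ∂Pr) := by
    rw [ofReal_integral_eq_lintegral_ofReal]
    · simp
    · exact (integrable_of_forall_abs_le hPV.ennreal_toReal (B := 1) fun ω => by
        rw [abs_of_nonneg ENNReal.toReal_nonneg]; exact measureReal_le_one).integrableOn
    · exact ae_of_all _ fun ω => measureReal_nonneg
  have e2 : ∫ ω in (fun ω => (Z ω, X n ω)) ⁻¹' U ∩ A, (P (X n ω)).real V ∂Pr =
      ∫ ω in (fun ω => (Z ω, X n ω)) ⁻¹' U ∩ A,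
        (X (n + 1) ⁻¹' V).indicator (fun _ => (1 : ℝ)) ω ∂Pr := by
    rw [setIntegral_congr_ae hAU' ((hX.condProb V hV n).symm.mono fun ω h _ => h),
      setIntegral_condExp (ℱ.le n) _ hAU]
    · rfl
    · exact (integrable_const (1 : ℝ)).indicator (hX.measurable (n + 1) hV)
  change _ = ∫⁻ ω in (fun ω => (Z ω, X n ω)) ⁻¹' U ∩ A, (P (X n ω)) V ∂Pr
  rw [e1, e2, integral_indicator_const _ (hX.measurable _ hV)]
  rw [smul_eq_mul, mul_one, Measure.real, ENNReal.ofReal_toReal (measure_ne_top _ _),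
    Measure.restrict_apply (hX.measurable _ hV)]
  congr 1
  ext ω
  simp only [Set.mem_inter_iff, Set.mem_preimage, Set.mem_prod]
  tauto

/-- The Markov property for bounded functions of the past and the next state. -/
theorem MarkovRel.condExp_eq (hX : MarkovRel Pr ℱ P X) {α : Type*}
    [MeasurableSpace α] {n : ℕ} {Z : Ω → α} (hZ : Measurable[ℱ n] Z) {F : α → S → ℝ}
    (hF : Measurable (Function.uncurry F)) {B : ℝ} (hB : ∀ z y, |F z y| ≤ B) :
    Pr[fun ω => F (Z ω) (X (n + 1) ω) | ℱ n] =ᵐ[Pr] fun ω => ∫ y, F (Z ω) y ∂P (X n ω) := by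
  have hW : Measurable[ℱ n] fun ω => (Z ω, X n ω) := hZ.prodMk (hX.adapted n)
  have hW' : Measurable fun ω => (Z ω, X n ω) := hW.mono (ℱ.le n) le_rfl
  have hG : Measurable fun q : (α × S) × S => F q.1.1 q.2 :=
    hF.comp ((measurable_fst.comp measurable_fst).prodMk measurable_snd)
  have hk : Measurable fun w : α × S => ∫ y, F w.1 y ∂P w.2 :=
    (hG.stronglyMeasurable.integral_kernel_prod_right' (κ := Kernel.prodMkLeft α P)).measurable
  have hkB : ∀ w : α × S, |∫ y, F w.1 y ∂P w.2| ≤ B := fun w =>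
    abs_integral_le_of_forall_abs_le fun y => hB _ y
  refine (ae_eq_condExp_of_forall_setIntegral_eq (ℱ.le n) ?_ ?_ ?_ ?_).symm
  · exact integrable_of_forall_abs_le (hG.comp (hW'.prodMk (hX.measurable _))) fun ω => hB _ _
  · exact fun A _ _ =>
      (integrable_of_forall_abs_le (hk.comp hW') fun ω => hkB (Z ω, X n ω)).integrableOn
  · intro A hA _
    have h1 := integral_map (μ := Pr.restrict A) hW'.aemeasurable
      (f := fun w : α × S => ∫ y, F w.1 y ∂P w.2) hk.aestronglyMeasurable
    have h2 := integral_map (μ := Pr.restrict A) (hW'.prodMk (hX.measurable (n + 1))).aemeasurable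
      (f := fun q : (α × S) × S => F q.1.1 q.2) hG.aestronglyMeasurable
    rw [hX.map_restrict_eq_compProd hZ hA, Measure.integral_compProd
      (integrable_of_forall_abs_le hG fun q => hB _ _)] at h2
    rw [← h1, ← h2]
    rfl
  · exact (hk.comp hW).stronglyMeasurable.aestronglyMeasurable

end MarkovProperty

/-! ### Noise driven by a uniformly ergodic chain is ODE-friendly -/

section MarkovNoise

variable {S : Type*} [MeasurableSpace S] {Ω : Type*} [mΩ : MeasurableSpace Ω]
variable {Pr : Measure Ω} [IsProbabilityMeasure Pr] {ℱ : Filtration ℕ mΩ} {P : Kernel S S}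
  [IsMarkovKernel P] {X : ℕ → Ω → S} {π : Measure S} [IsProbabilityMeasure π] {D ρ : ℝ}

/-- Noise with a slowly varying parameter. With `ĝ` the solution of Poisson's equation for
`g θ x = ∫ h θ x y P(x, dy)`, the martingale difference is the centred version of
`h θₙ Xₙ Xₙ₊₁ + ĝ θₙ Xₙ₊₁`, the telescoping term is `-ĝ θₙ Xₙ`, and the remainder
`ĝ θₙ₊₁ Xₙ₊₁ - ĝ θₙ Xₙ₊₁` is small because `ĝ` inherits the Lipschitz property of `g`. -/
theorem MarkovRel.odeFriendly (hX : MarkovRel Pr ℱ P X) (hP : GeomErgodic P π D ρ)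
    {Θ : Type*} [MeasurableSpace Θ] [PseudoMetricSpace Θ] {h : Θ → S → S → ℝ}
    (hh : Measurable fun q : (Θ × S) × S => h q.1.1 q.1.2 q.2) {B : ℝ}
    (hB : ∀ θ x y, |h θ x y| ≤ B) {K : ℝ}
    (hLip : ∀ θ θ' x, |∫ y, h θ x y ∂P x - ∫ y, h θ' x y ∂P x| ≤ K * dist θ θ')
    {θ : ℕ → Ω → Θ} (hθ : ∀ n, Measurable[ℱ n] (θ n)) {γ : ℕ → ℝ} (hγ : ∀ n, 0 ≤ γ n)
    (hsum : ∀ᵐ ω ∂Pr, Summable fun k : ℕ => γ (k + 1) * dist (θ (k + 1) ω) (θ k ω))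
    {E : ℕ → Ω → ℝ} (hE : ∀ n ω, E (n + 1) ω = h (θ n ω) (X n ω) (X (n + 1) ω)
      - ∫ p, h (θ n ω) p.1 p.2 ∂(π ⊗ₘ P)) :
    ODEFriendly Pr ℱ γ E := by
  let g : Θ → S → ℝ := fun θ x => ∫ y, h θ x y ∂P x
  have hgm : Measurable (Function.uncurry g) :=
    (hh.stronglyMeasurable.integral_kernel_prod_right' (κ := Kernel.prodMkLeft Θ P)).measurable
  have hgB : ∀ θ x, |g θ x| ≤ B := fun θ x => abs_integral_le_of_forall_abs_le (hB θ x)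
  have hgθ : ∀ θ, Measurable (g θ) := fun θ => hgm.comp measurable_prodMk_left
  let u : Θ → S → ℝ := fun θ x => poissonSol P π (g θ) x
  have hum : Measurable (Function.uncurry u) := measurable_poissonSol_uncurry hP hgm hgB
  obtain ⟨C, hC⟩ : ∃ C, C = 2 * D / (1 - ρ) := ⟨_, rfl⟩
  have huB : ∀ θ x, |u θ x| ≤ C * B := fun θ x => by
    rw [hC]; exact hP.abs_poissonSol_le (hgθ θ) (hgB θ) x
  have huLip : ∀ θ θ' x, |u θ x - u θ' x| ≤ C * (K * dist θ θ') := by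
    intro θ θ' x
    have e := hP.poissonSol_sub (hgθ θ) (hgθ θ') (hgB θ) (hgB θ') x
    have := hP.abs_poissonSol_le ((hgθ θ).sub (hgθ θ')) (hLip θ θ') x
    rw [hC]
    rwa [show (g θ - g θ') = fun y => g θ y - g θ' y from rfl, e] at this
  have hmean : ∀ θ, ∫ p, h θ p.1 p.2 ∂(π ⊗ₘ P) = ∫ x, g θ x ∂π := fun θ =>
    Measure.integral_compProd (integrable_of_forall_abs_le
      (hh.comp ((measurable_const.prodMk measurable_fst).prodMk measurable_snd)) fun p => hB _ _ _)
  have hmeanm : Measurable fun θ => ∫ x, g θ x ∂π :=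
    (hgm.stronglyMeasurable.integral_kernel_prod_right' (κ := Kernel.const Θ π)).measurable
  have hmeanB : ∀ θ, |∫ x, g θ x ∂π| ≤ B := fun θ => abs_integral_le_of_forall_abs_le (hgB θ)
  -- the next-state function whose fluctuation is the martingale difference
  let F : Θ × S → S → ℝ := fun z y => h z.1 z.2 y + u z.1 y
  have hF : Measurable (Function.uncurry F) :=
    hh.add (hum.comp ((measurable_fst.comp measurable_fst).prodMk measurable_snd))
  have hFB : ∀ z y, |F z y| ≤ B + C * B := fun z y =>
    (abs_add_le _ _).trans (add_le_add (hB _ _ _) (huB _ _))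
  have hFint : ∀ θ x, ∫ y, F (θ, x) y ∂P x = u θ x + ∫ x, g θ x ∂π := by
    intro θ x
    have : ∫ y, F (θ, x) y ∂P x = g θ x + ∫ y, u θ y ∂P x := by
      refine integral_add (integrable_of_forall_abs_le ?_ (hB θ x))
        (integrable_of_forall_abs_le ?_ (huB θ))
      · exact hh.comp measurable_prodMk_left
      · exact hum.comp measurable_prodMk_left
    rw [this, hP.integral_poissonSol (hgθ θ) (hgB θ)]
    simp only [u]
    ring
  have hZ : ∀ n, Measurable[ℱ n] fun ω => (θ n ω, X n ω) := fun n => (hθ n).prodMk (hX.adapted n)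
  have hθ' : ∀ n m, n ≤ m → Measurable[ℱ m] (θ n) := fun n m hnm =>
    (hθ n).mono (ℱ.mono hnm) le_rfl
  have hX' : ∀ n m, n ≤ m → Measurable[ℱ m] (X n) := fun n m hnm =>
    (hX.adapted n).mono (ℱ.mono hnm) le_rfl
  let G : Θ × S → S → ℝ := fun z y => F z y - (u z.1 z.2 + ∫ x, g z.1 x ∂π)
  have hGm : Measurable (Function.uncurry G) :=
    hF.sub ((hum.comp measurable_fst).add (hmeanm.comp (measurable_fst.comp measurable_fst)))
  have hGB : ∀ z y, |G z y| ≤ (B + C * B) + (C * B + B) := fun z y =>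
    (abs_sub _ _).trans (add_le_add (hFB _ _)
      ((abs_add_le _ _).trans (add_le_add (huB _ _) (hmeanB _))))
  have hGsm : ∀ n, Measurable[ℱ (n + 1)] fun ω => G (θ n ω, X n ω) (X (n + 1) ω) := fun n =>
    hGm.comp (((hθ' n _ n.le_succ).prodMk (hX' n _ n.le_succ)).prodMk (hX.adapted (n + 1)))
  have hTm : ∀ k, Measurable[ℱ k] fun ω => -u (θ k ω) (X k ω) := fun k => (hum.comp (hZ k)).neg
  have hεm : ∀ n, Measurable[ℱ (n + 1)]
      fun ω => u (θ (n + 1) ω) (X (n + 1) ω) - u (θ n ω) (X (n + 1) ω) := fun n =>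
    (hum.comp (hZ (n + 1))).sub (hum.comp ((hθ' n _ n.le_succ).prodMk (hX.adapted (n + 1))))
  refine ⟨fun k ω => G (θ (k - 1) ω, X (k - 1) ω) (X k ω), fun k ω => -u (θ k ω) (X k ω),
    fun k ω => u (θ k ω) (X k ω) - u (θ (k - 1) ω) (X k ω), ?_, ?_, ?_, ?_, ?_, ?_, ?_, ?_⟩
  · intro k hk ω
    obtain ⟨n, rfl⟩ := Nat.exists_eq_add_of_le' hk
    rw [hE, hmean]
    simp only [Nat.add_sub_cancel, G, F]
    ring
  · intro k hk
    obtain ⟨n, rfl⟩ := Nat.exists_eq_add_of_le' hk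
    simp only [Nat.add_sub_cancel]
    refine ⟨(hGsm n).stronglyMeasurable,
      integrable_of_forall_abs_le ((hGsm n).mono (ℱ.le _) le_rfl) fun ω => hGB _ _, ?_⟩
    filter_upwards [hX.condExp_eq (hZ n) hGm hGB] with ω hω
    rw [hω]
    have : ∫ y, G (θ n ω, X n ω) y ∂P (X n ω) =
        ∫ y, F (θ n ω, X n ω) y ∂P (X n ω) - (u (θ n ω) (X n ω) + ∫ x, g (θ n ω) x ∂π) := by
      have hFi : Integrable (F (θ n ω, X n ω)) (P (X n ω)) :=
        integrable_of_forall_abs_le (hF.comp measurable_prodMk_left) (hFB _)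
      simp only [G]
      rw [integral_sub hFi (integrable_const _)]
      simp
    rw [this, hFint, sub_self]
    rfl
  · obtain ⟨σ, hσ⟩ : ∃ σ, σ = (B + C * B) + (C * B + B) := ⟨_, rfl⟩
    refine ⟨σ, fun k hk => ?_⟩
    obtain ⟨n, rfl⟩ := Nat.exists_eq_add_of_le' hk
    simp only [Nat.add_sub_cancel, Real.norm_eq_abs, sq_abs]
    have hsq : ∀ ω, G (θ n ω, X n ω) (X (n + 1) ω) ^ 2 ≤ σ ^ 2 := fun ω => by
      rw [hσ]; exact sq_le_sq' (neg_le_of_abs_le (hGB _ _)) (le_of_abs_le (hGB _ _))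
    have hi : Integrable (fun ω => G (θ n ω, X n ω) (X (n + 1) ω) ^ 2) Pr :=
      integrable_of_forall_abs_le (((hGsm n).pow_const 2).mono (ℱ.le _) le_rfl) (B := σ ^ 2)
        fun ω => by rw [abs_of_nonneg (sq_nonneg _)]; exact hsq ω
    refine ⟨hi, ?_⟩
    rw [condExp_of_stronglyMeasurable (ℱ.le _) ((hGsm n).pow_const 2).stronglyMeasurable hi]
    exact ae_of_all _ hsq
  · exact fun k => ((hTm k).mono (ℱ.le k) le_rfl).stronglyMeasurable
  · exact ⟨C * B, fun k => ae_of_all _ fun ω => by rw [norm_neg]; exact huB _ _⟩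
  · intro k hk
    obtain ⟨n, rfl⟩ := Nat.exists_eq_add_of_le' hk
    exact ((hεm n).mono (ℱ.le _) le_rfl).stronglyMeasurable
  · exact ⟨C * B + C * B, fun k _ => ae_of_all _ fun ω =>
      (abs_sub _ _).trans (add_le_add (huB _ _) (huB _ _))⟩
  · filter_upwards [hsum] with ω hω
    refine (hω.mul_left (C * K)).of_norm_bounded fun k => ?_
    simp only [Nat.add_sub_cancel]
    rw [norm_mul, norm_norm, Real.norm_of_nonneg (hγ _), Real.norm_eq_abs]
    calc γ (k + 1) * |u (θ (k + 1) ω) (X (k + 1) ω) - u (θ k ω) (X (k + 1) ω)|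
        ≤ γ (k + 1) * (C * (K * dist (θ (k + 1) ω) (θ k ω))) :=
          mul_le_mul_of_nonneg_left (huLip _ _ _) (hγ _)
      _ = C * K * (γ (k + 1) * dist (θ (k + 1) ω) (θ k ω)) := by ring

end MarkovNoise

/-- A random vector sequence is ODE-friendly if its components are. -/
theorem ODEFriendly.of_components {Ω : Type*} [mΩ : MeasurableSpace Ω] {Pr : Measure Ω}
    [IsProbabilityMeasure Pr] {ℱ : Filtration ℕ mΩ} {γ : ℕ → ℝ} (hγ : ∀ n, 0 ≤ γ n)
    {ι F : Type*} [Fintype ι] [NormedAddCommGroup F] [NormedSpace ℝ F] [CompleteSpace F]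
    {E : ℕ → Ω → ι → F} (h : ∀ i, ODEFriendly Pr ℱ γ fun k ω => E k ω i) :
    ODEFriendly Pr ℱ γ E := by
  choose Δ T ε hdec hmart hvar hTm hTb hεm hεb hεs using h
  choose σ hσ using hvar
  choose BT hBT using hTb
  choose Bε hBε using hεb
  have hsm : ∀ (m : MeasurableSpace Ω) (f : Ω → ι → F),
      (∀ i, StronglyMeasurable[m] fun ω => f ω i) → StronglyMeasurable[m] f :=
    fun m f hf => by
      classical
      have : f = fun ω => ∑ i, Pi.single i (f ω i) := by
        ext ω i
        simp
      rw [this]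
      exact Finset.stronglyMeasurable_fun_sum _ fun i _ =>
        (continuous_single (A := fun _ : ι => F) i).comp_stronglyMeasurable (hf i)
  have hΔb : ∀ k, 1 ≤ k → ∀ᵐ ω ∂Pr, ‖(fun i => Δ i k ω)‖ ^ 2 ≤ ∑ i, σ i ^ 2 := by
    intro k hk
    have : ∀ i, ∀ᵐ ω ∂Pr, ‖Δ i k ω‖ ^ 2 ≤ σ i ^ 2 := by
      intro i
      have := (hσ i k hk).2
      have hm : StronglyMeasurable[ℱ k] fun ω => ‖Δ i k ω‖ ^ 2 := (hmart i k hk).1.norm.pow 2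
      rwa [condExp_of_stronglyMeasurable (ℱ.le k) hm (hσ i k hk).1] at this
    filter_upwards [ae_all_iff.2 this] with ω hω
    have h0 : 0 ≤ ∑ i, σ i ^ 2 := Finset.sum_nonneg fun i _ => sq_nonneg _
    rw [← Real.le_sqrt (norm_nonneg _) h0, pi_norm_le_iff_of_nonneg (Real.sqrt_nonneg _)]
    intro i
    rw [Real.le_sqrt (norm_nonneg _) h0]
    exact (hω i).trans (Finset.single_le_sum (f := fun i => σ i ^ 2) (fun i _ => sq_nonneg _)
      (Finset.mem_univ i))
  have hΔsm : ∀ k, 1 ≤ k → StronglyMeasurable[ℱ k] fun ω i => Δ i k ω := fun k hk =>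
    hsm _ _ fun i => (hmart i k hk).1
  have hΔi : ∀ k, 1 ≤ k → Integrable (fun ω i => Δ i k ω) Pr := fun k hk =>
    Integrable.of_eval fun i => (hmart i k hk).2.1
  refine ⟨fun k ω i => Δ i k ω, fun k ω i => T i k ω, fun k ω i => ε i k ω, ?_, ?_, ?_, ?_, ?_, ?_,
    ?_, ?_⟩
  · exact fun k hk ω => funext fun i => hdec i k hk ω
  · intro k hk
    refine ⟨hΔsm k hk, hΔi k hk, ?_⟩
    have : ∀ i, ∀ᵐ ω ∂Pr, (Pr[fun ω i => Δ i k ω | ℱ (k - 1)]) ω i = 0 := by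
      intro i
      filter_upwards [(ContinuousLinearMap.proj (R := ℝ) (φ := fun _ : ι => F) i).comp_condExp_comm
        (m := ℱ (k - 1)) (hΔi k hk), (hmart i k hk).2.2] with ω h1 h2
      exact h1.trans h2
    filter_upwards [ae_all_iff.2 this] with ω hω
    exact funext hω
  · refine ⟨√(∑ i, σ i ^ 2), fun k hk => ?_⟩
    rw [Real.sq_sqrt (Finset.sum_nonneg fun i _ => sq_nonneg _)]
    have hm : StronglyMeasurable[ℱ k] fun ω => ‖(fun i => Δ i k ω)‖ ^ 2 :=
      (hΔsm k hk).norm.pow 2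
    have hi : Integrable (fun ω => ‖(fun i => Δ i k ω)‖ ^ 2) Pr :=
      Integrable.of_bound (hm.mono (ℱ.le k)).aestronglyMeasurable (∑ i, σ i ^ 2)
        ((hΔb k hk).mono fun ω h => by
          rwa [Real.norm_of_nonneg (pow_nonneg (norm_nonneg _) 2)])
    refine ⟨hi, ?_⟩
    rw [condExp_of_stronglyMeasurable (ℱ.le k) hm hi]
    exact hΔb k hk
  · exact fun k => hsm _ _ fun i => hTm i k
  · refine ⟨∑ i, |BT i|, fun k => ?_⟩
    filter_upwards [ae_all_iff.2 fun i => hBT i k] with ω hω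
    rw [pi_norm_le_iff_of_nonneg (Finset.sum_nonneg fun i _ => abs_nonneg _)]
    exact fun i => ((hω i).trans (le_abs_self _)).trans (Finset.single_le_sum
      (f := fun i => |BT i|) (fun i _ => abs_nonneg _) (Finset.mem_univ i))
  · exact fun k hk => hsm _ _ fun i => hεm i k hk
  · refine ⟨∑ i, |Bε i|, fun k hk => ?_⟩
    filter_upwards [ae_all_iff.2 fun i => hBε i k hk] with ω hω
    rw [pi_norm_le_iff_of_nonneg (Finset.sum_nonneg fun i _ => abs_nonneg _)]
    exact fun i => ((hω i).trans (le_abs_self _)).trans (Finset.single_le_sum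
      (f := fun i => |Bε i|) (fun i _ => abs_nonneg _) (Finset.mem_univ i))
  · filter_upwards [ae_all_iff.2 hεs] with ω hω
    refine (summable_sum fun i (_ : i ∈ Finset.univ) => hω i).of_norm_bounded fun k => ?_
    rw [norm_mul, norm_norm, Real.norm_of_nonneg (hγ _), ← Finset.mul_sum]
    refine mul_le_mul_of_nonneg_left ?_ (hγ _)
    rw [pi_norm_le_iff_of_nonneg (Finset.sum_nonneg fun i _ => norm_nonneg _)]
    exact fun i => Finset.single_le_sum
      (f := fun i => ‖ε i (k + 1) ω‖) (fun i _ => norm_nonneg _) (Finset.mem_univ i)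

/-! ### Averaging of ODE-friendly noise -/

/-- `L²`-bounded martingale convergence for a weighted sum of bounded martingale differences. -/
theorem ae_exists_tendsto_sum_martingaleDiff {Ω : Type*} [mΩ : MeasurableSpace Ω] {Pr : Measure Ω}
    [IsProbabilityMeasure Pr] {ℱ : Filtration ℕ mΩ} {γ : ℕ → ℝ} {Δ : ℕ → Ω → ℝ} {σ : ℝ}
    (hΔ : ∀ k, 1 ≤ k → StronglyMeasurable[ℱ k] (Δ k) ∧ Integrable (Δ k) Pr ∧
      Pr[Δ k | ℱ (k - 1)] =ᵐ[Pr] 0)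
    (hσ : ∀ k, 1 ≤ k → ∀ᵐ ω ∂Pr, Δ k ω ^ 2 ≤ σ ^ 2)
    (hγ : Summable fun k => γ (k + 1) ^ 2) :
    ∀ᵐ ω ∂Pr, ∃ l, Tendsto (fun n => ∑ k ∈ Finset.range n, γ (k + 1) * Δ (k + 1) ω)
      atTop (𝓝 l) := by
  obtain ⟨V, hV⟩ : ∃ V : ℕ → Ω → ℝ,
    ∀ n ω, V n ω = ∑ k ∈ Finset.range n, γ (k + 1) * Δ (k + 1) ω := ⟨_, fun _ _ => rfl⟩
  have hVs : ∀ n, V (n + 1) = fun ω => V n ω + γ (n + 1) * Δ (n + 1) ω := fun n => by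
    ext ω; rw [hV, hV, Finset.sum_range_succ]
  have hV0 : V 0 = fun _ => 0 := by ext ω; simp [hV]
  have hVm : ∀ n, StronglyMeasurable[ℱ n] (V n) := by
    intro n
    induction n with
    | zero => rw [hV0]; exact stronglyMeasurable_const
    | succ n ih =>
      rw [hVs]
      exact (ih.mono (ℱ.mono n.le_succ)).add ((hΔ (n + 1) (by omega)).1.const_mul _)
  have hΔL : ∀ n, MemLp (Δ (n + 1)) ∞ Pr := fun n =>
    memLp_top_of_bound ((hΔ (n + 1) (by omega)).1.mono (ℱ.le _)).aestronglyMeasurable |σ|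
      ((hσ (n + 1) (by omega)).mono fun ω h => by simpa using sq_le_sq.1 h)
  have hVL : ∀ n, MemLp (V n) ∞ Pr := by
    intro n
    induction n with
    | zero => rw [hV0]; exact MemLp.zero
    | succ n ih => rw [hVs]; exact ih.add ((hΔL n).const_mul _)
  have hVi : ∀ n, Integrable (V n) Pr := fun n => (hVL n).integrable le_top
  have hVsq : ∀ n, Integrable (fun ω => V n ω ^ 2) Pr := fun n =>
    ((hVL n).mono_exponent le_top : MemLp (V n) 2 Pr).integrable_sq
  have hΔsq : ∀ n, Integrable (fun ω => Δ (n + 1) ω ^ 2) Pr := fun n =>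
    ((hΔL n).mono_exponent le_top : MemLp (Δ (n + 1)) 2 Pr).integrable_sq
  have hVΔ : ∀ n, Integrable (V n * Δ (n + 1)) Pr := fun n =>
    MemLp.integrable_mul ((hVL n).mono_exponent le_top : MemLp (V n) 2 Pr)
      ((hΔL n).mono_exponent le_top : MemLp (Δ (n + 1)) 2 Pr)
  have horth : ∀ n, ∫ ω, (V n * Δ (n + 1)) ω ∂Pr = 0 := by
    intro n
    rw [← integral_condExp (ℱ.le n)]
    refine (integral_congr_ae ?_).trans (integral_zero _ _)
    filter_upwards [condExp_mul_of_stronglyMeasurable_left (hVm n) (hVΔ n)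
      (hΔ (n + 1) (by omega)).2.1, (hΔ (n + 1) (by omega)).2.2] with ω h1 h2
    rw [h1, Pi.mul_apply]
    simp only [Nat.add_sub_cancel] at h2
    rw [h2]
    simp
  have hmart : Martingale V ℱ Pr := by
    refine martingale_of_condExp_sub_eq_zero_nat hVm hVi fun n => ?_
    have : V (n + 1) - V n = γ (n + 1) • Δ (n + 1) := by
      rw [hVs]; ext ω; simp
    rw [this]
    filter_upwards [condExp_smul (μ := Pr) (γ (n + 1)) (Δ (n + 1)) (ℱ n),
      (hΔ (n + 1) (by omega)).2.2] with ω h1 h2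
    rw [h1, Pi.smul_apply]
    simp only [Nat.add_sub_cancel] at h2
    rw [h2]
    simp
  -- the cross terms vanish by orthogonality of the increments
  have hsecond : ∀ n, ∫ ω, V n ω ^ 2 ∂Pr ≤ ∑ k ∈ Finset.range n, γ (k + 1) ^ 2 * σ ^ 2 := by
    intro n
    induction n with
    | zero => simp [hV0]
    | succ n ih =>
      have e : ∫ ω, V (n + 1) ω ^ 2 ∂Pr = ∫ ω, V n ω ^ 2 ∂Pr
          + (2 * γ (n + 1)) * ∫ ω, (V n * Δ (n + 1)) ω ∂Pr
          + γ (n + 1) ^ 2 * ∫ ω, Δ (n + 1) ω ^ 2 ∂Pr := by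
        have hi : Integrable (fun ω => V n ω ^ 2 + 2 * γ (n + 1) * (V n * Δ (n + 1)) ω) Pr :=
          (hVsq n).add ((hVΔ n).const_mul _)
        rw [← integral_const_mul, ← integral_const_mul, ← integral_add (hVsq n)
          ((hVΔ n).const_mul _), ← integral_add hi ((hΔsq n).const_mul _), hVs]
        congr 1
        ext ω
        simp only [Pi.mul_apply]
        ring
      have hΔ2 : ∫ ω, Δ (n + 1) ω ^ 2 ∂Pr ≤ σ ^ 2 := by
        have := integral_mono_ae (hΔsq n) (integrable_const (σ ^ 2)) (hσ (n + 1) (by omega))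
        simpa using this
      rw [e, horth, Finset.sum_range_succ]
      nlinarith [mul_le_mul_of_nonneg_left hΔ2 (sq_nonneg (γ (n + 1)))]
  obtain ⟨R, hR⟩ : ∃ R : NNReal, ∀ n, eLpNorm (V n) 1 Pr ≤ R := by
    refine ⟨(1 + ∑' k, γ (k + 1) ^ 2 * σ ^ 2).toNNReal, fun n => ?_⟩
    rw [eLpNorm_one_eq_lintegral_enorm, ← ofReal_integral_norm_eq_lintegral_enorm (hVi n)]
    refine ENNReal.ofReal_le_ofReal ?_
    have h1 : ∫ ω, ‖V n ω‖ ∂Pr ≤ ∫ ω, (1 + V n ω ^ 2) ∂Pr := by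
      refine integral_mono (hVi n).norm ((integrable_const 1).add (hVsq n)) fun ω => ?_
      simp only [Real.norm_eq_abs]
      nlinarith [sq_abs (V n ω), sq_nonneg (|V n ω| - 1)]
    have h2 : ∫ ω, (1 + V n ω ^ 2) ∂Pr = 1 + ∫ ω, V n ω ^ 2 ∂Pr := by
      rw [integral_add (integrable_const 1) (hVsq n)]; simp
    have h3 := (hγ.mul_right (σ ^ 2)).sum_le_tsum (Finset.range n) fun k _ => by positivity
    linarith [hsecond n]
  filter_upwards [hmart.submartingale.exists_ae_tendsto_of_bdd hR] with ω hω
  simpa only [hV] using hω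

/-- The series `∑ γₖ 𝓔ₖ` of a real ODE-friendly sequence converges almost surely when `γ` decreases
to zero and is square-summable: the three parts of the decomposition are handled by martingale
convergence, by Abel summation and by absolute convergence. -/
theorem ODEFriendly.ae_exists_tendsto_sum {Ω : Type*} [mΩ : MeasurableSpace Ω] {Pr : Measure Ω}
    [IsProbabilityMeasure Pr] {ℱ : Filtration ℕ mΩ} {γ : ℕ → ℝ} {E : ℕ → Ω → ℝ}
    (hE : ODEFriendly Pr ℱ γ E) (hanti : Antitone fun k => γ (k + 1))
    (hlim : Tendsto (fun k => γ (k + 1)) atTop (𝓝 0)) (hsq : Summable fun k => γ (k + 1) ^ 2) :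
    ∀ᵐ ω ∂Pr, ∃ l, Tendsto (fun n => ∑ k ∈ Finset.range n, γ (k + 1) * E (k + 1) ω)
      atTop (𝓝 l) := by
  obtain ⟨Δ, T, ε, hdec, hmart, ⟨σ, hσ⟩, -, ⟨B, hB⟩, -, -, hε⟩ := hE
  have hσ' : ∀ k, 1 ≤ k → ∀ᵐ ω ∂Pr, Δ k ω ^ 2 ≤ σ ^ 2 := by
    intro k hk
    have hm : StronglyMeasurable[ℱ k] fun ω => ‖Δ k ω‖ ^ 2 := (hmart k hk).1.norm.pow 2
    have := (hσ k hk).2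
    rw [condExp_of_stronglyMeasurable (ℱ.le k) hm (hσ k hk).1] at this
    simpa only [Real.norm_eq_abs, sq_abs] using this
  filter_upwards [ae_exists_tendsto_sum_martingaleDiff hmart hσ' hsq, hε, ae_all_iff.2 hB]
    with ω ⟨l₁, h₁⟩ h₂ h₃
  have hc : CauchySeq fun n => ∑ k ∈ Finset.range n, γ (k + 1) • (T (k + 1) ω - T k ω) := by
    refine hanti.cauchySeq_series_mul_of_tendsto_zero_of_bounded (b := B + B) hlim fun n => ?_
    rw [Finset.sum_range_sub (fun k => T k ω)]
    exact (norm_sub_le _ _).trans (add_le_add (h₃ _) (h₃ _))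
  obtain ⟨l₂, hl₂⟩ := cauchySeq_tendsto_of_complete hc
  have hs : Summable fun k => γ (k + 1) * ε (k + 1) ω := by
    refine Summable.of_norm (h₂.abs.congr fun k => ?_)
    rw [norm_mul, abs_mul, abs_norm, Real.norm_eq_abs (γ _)]
  refine ⟨l₁ + l₂ + ∑' k, γ (k + 1) * ε (k + 1) ω, ?_⟩
  refine ((h₁.add hl₂).add hs.hasSum.tendsto_sum_nat).congr fun n => ?_
  rw [← Finset.sum_add_distrib, ← Finset.sum_add_distrib]
  refine Finset.sum_congr rfl fun k _ => ?_
  rw [hdec (k + 1) (by omega), smul_eq_mul, Nat.add_sub_cancel]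
  ring

/-- A convex-combination recursion driven by a null sequence tends to zero if the step sizes have
divergent sum. -/
theorem tendsto_zero_of_averaging {γ U R : ℕ → ℝ} (h0 : ∀ n, 0 ≤ γ n) (h1 : ∀ n, γ n ≤ 1)
    (hdiv : ¬ Summable γ) (hR : Tendsto R atTop (𝓝 0))
    (hU : ∀ n, U (n + 1) = (1 - γ n) * U n + γ n * R n) : Tendsto U atTop (𝓝 0) := by
  have hG := (not_summable_iff_tendsto_nat_atTop_of_nonneg h0).1 hdiv
  rw [Metric.tendsto_atTop] at hR ⊢
  intro e he
  obtain ⟨N, hN⟩ := hR (e / 2) (half_pos he)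
  simp only [Real.dist_eq, sub_zero] at hN ⊢
  have key : ∀ n, N ≤ n → |U n| ≤ e / 2 + Real.exp (∑ k ∈ Finset.range N, γ k
      - ∑ k ∈ Finset.range n, γ k) * |U N| := by
    intro n hn
    induction n, hn using Nat.le_induction with
    | base => simp [(half_pos he).le]
    | succ n hn ih =>
      have ha : |U (n + 1)| ≤ (1 - γ n) * |U n| + γ n * (e / 2) := by
        rw [hU]
        refine (abs_add_le _ _).trans ?_
        rw [abs_mul, abs_mul, abs_of_nonneg (sub_nonneg.2 (h1 n)), abs_of_nonneg (h0 n)]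
        exact add_le_add le_rfl (mul_le_mul_of_nonneg_left (hN n hn).le (h0 n))
      have hexp : 1 - γ n ≤ Real.exp (-γ n) := by
        have := Real.add_one_le_exp (-γ n); linarith
      rw [Finset.sum_range_succ, ← sub_sub, sub_eq_add_neg _ (γ n), Real.exp_add]
      set q := Real.exp (∑ k ∈ Finset.range N, γ k - ∑ k ∈ Finset.range n, γ k)
      have hq : 0 ≤ q * |U N| := mul_nonneg (Real.exp_nonneg _) (abs_nonneg _)
      have h2 := mul_le_mul_of_nonneg_left ih (sub_nonneg.2 (h1 n))
      have h3 := mul_le_mul_of_nonneg_right hexp hq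
      nlinarith
  have hlim : Tendsto (fun n => Real.exp (∑ k ∈ Finset.range N, γ k
      - ∑ k ∈ Finset.range n, γ k) * |U N|) atTop (𝓝 0) := by
    rw [← zero_mul |U N|]
    refine Tendsto.mul_const _ (Real.tendsto_exp_atBot.comp ?_)
    exact tendsto_atBot_add_const_left _ _ (tendsto_neg_atTop_atBot.comp hG)
  obtain ⟨N', hN'⟩ := (Metric.tendsto_atTop.1 hlim) (e / 2) (half_pos he)
  refine ⟨max N N', fun n hn => ?_⟩
  have h4 := key n (le_trans (le_max_left _ _) hn)
  have h5 := hN' n (le_trans (le_max_right _ _) hn)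
  rw [Real.dist_eq, sub_zero] at h5
  linarith [le_abs_self (Real.exp (∑ k ∈ Finset.range N, γ k
      - ∑ k ∈ Finset.range n, γ k) * |U N|)]

/-- The recursion `sₙ₊₁ = sₙ + γₙ (eₙ - sₙ)`. -/
def averaged {E : Type*} [AddCommGroup E] [Module ℝ E] (γ : ℕ → ℝ) (e : ℕ → E) (s₀ : E) : ℕ → E
  | 0 => s₀
  | n + 1 => averaged γ e s₀ n + γ n • (e n - averaged γ e s₀ n)

/-- Stochastic-approximation averages of a sequence `e` with `∑ γₖ eₖ` convergent tend to zero: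
adding the tail of the series to `s` gives a recursion driven by that tail. -/
theorem tendsto_zero_of_tendsto_sum {γ s e : ℕ → ℝ} (h0 : ∀ n, 0 ≤ γ n) (h1 : ∀ n, γ n ≤ 1)
    (hdiv : ¬ Summable γ) {l : ℝ}
    (he : Tendsto (fun n => ∑ k ∈ Finset.range n, γ k * e k) atTop (𝓝 l))
    (hs : ∀ n, s (n + 1) = s n + γ n * (e n - s n)) : Tendsto s atTop (𝓝 0) := by
  have hR : Tendsto (fun n => l - ∑ k ∈ Finset.range n, γ k * e k) atTop (𝓝 0) := by
    simpa using he.const_sub l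
  have hU := tendsto_zero_of_averaging
    (U := fun n => s n + (l - ∑ k ∈ Finset.range n, γ k * e k)) h0 h1 hdiv hR fun n => by
      simp only [hs, Finset.sum_range_succ]
      ring
  simpa using hU.sub hR

/-! ### The pseudo-inverse and quadratic forms -/

/-- The pseudo-inverse is a Borel map: its graph is the closed set cut out by the Penrose
equations, and the first projection is injective on it, so the Lusin–Souslin theorem applies. -/
theorem measurable_pinv {d : ℕ} :
    Measurable fun A : Fin d → Fin d → ℝ => Matrix.of.symm (pinv (Matrix.of A)) := by
  let graph : Set ((Fin d → Fin d → ℝ) × (Fin d → Fin d → ℝ)) :=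
    {p | IsMoorePenrose (Matrix.of p.1) (Matrix.of p.2)}
  have hcl : IsClosed graph := by
    have e : graph = {p | Matrix.of p.1 * Matrix.of p.2 * Matrix.of p.1 = Matrix.of p.1} ∩
        {p | Matrix.of p.2 * Matrix.of p.1 * Matrix.of p.2 = Matrix.of p.2} ∩
        {p | (Matrix.of p.1 * Matrix.of p.2)ᵀ = Matrix.of p.1 * Matrix.of p.2} ∩
        {p | (Matrix.of p.2 * Matrix.of p.1)ᵀ = Matrix.of p.2 * Matrix.of p.1} := by
      ext p
      exact ⟨fun h => ⟨⟨⟨h.1, h.2⟩, h.3⟩, h.4⟩, fun h => ⟨h.1.1.1, h.1.1.2, h.1.2, h.2⟩⟩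
    have c1 : Continuous fun p : (Fin d → Fin d → ℝ) × (Fin d → Fin d → ℝ) =>
      (Matrix.of p.1 : Matrix (Fin d) (Fin d) ℝ) := continuous_fst
    have c2 : Continuous fun p : (Fin d → Fin d → ℝ) × (Fin d → Fin d → ℝ) =>
      (Matrix.of p.2 : Matrix (Fin d) (Fin d) ℝ) := continuous_snd
    rw [e]
    refine (((isClosed_eq ?_ c1).inter (isClosed_eq ?_ c2)).inter (isClosed_eq ?_ ?_)).inter
      (isClosed_eq ?_ ?_)
    · exact (c1.matrix_mul c2).matrix_mul c1
    · exact (c2.matrix_mul c1).matrix_mul c2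
    · exact (c1.matrix_mul c2).matrix_transpose
    · exact c1.matrix_mul c2
    · exact (c2.matrix_mul c1).matrix_transpose
    · exact c2.matrix_mul c1
  intro U hU
  have e : (fun A : Fin d → Fin d → ℝ => Matrix.of.symm (pinv (Matrix.of A))) ⁻¹' U =
      Prod.fst '' (graph ∩ Prod.snd ⁻¹' U) := by
    ext A
    constructor
    · exact fun hA => ⟨(A, Matrix.of.symm (pinv (Matrix.of A))), ⟨pinv_spec (Matrix.of A), hA⟩, rfl⟩
    · rintro ⟨⟨A', B⟩, ⟨hg, hB⟩, rfl⟩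
      have : pinv (Matrix.of A') = Matrix.of B := (pinv_spec _).unique hg
      rw [Set.mem_preimage, this]
      exact hB
  rw [e]
  refine (hcl.measurableSet.inter (measurable_snd hU)).image_of_measurable_injOn measurable_fst ?_
  rintro ⟨A, B⟩ ⟨hB, -⟩ ⟨A', C⟩ ⟨hC, -⟩ (rfl : A = A')
  exact Prod.ext rfl (IsMoorePenrose.unique hB hC)

theorem dotProduct_mulVec_eq_sum {d : ℕ} (S : Matrix (Fin d) (Fin d) ℝ) (v : Fin d → ℝ) :
    v ⬝ᵥ (S *ᵥ v) = ∑ i, ∑ j, v i * S i j * v j := by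
  simp only [dotProduct, mulVec, Finset.mul_sum, mul_assoc]

theorem dotProduct_mulVec_le {d : ℕ} (S : Matrix (Fin d) (Fin d) ℝ) (v : Fin d → ℝ) :
    v ⬝ᵥ (S *ᵥ v) ≤ (∑ i, ∑ j, |S i j|) * ‖v‖ ^ 2 := by
  rw [dotProduct_mulVec_eq_sum, Finset.sum_mul]
  refine Finset.sum_le_sum fun i _ => ?_
  rw [Finset.sum_mul]
  refine Finset.sum_le_sum fun j _ => ?_
  refine (le_abs_self _).trans ?_
  rw [abs_mul, abs_mul]
  have hi : |v i| ≤ ‖v‖ := norm_le_pi_norm v i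
  have hj : |v j| ≤ ‖v‖ := norm_le_pi_norm v j
  calc |v i| * |S i j| * |v j| = |S i j| * (|v i| * |v j|) := by ring
    _ ≤ |S i j| * (‖v‖ * ‖v‖) := by gcongr
    _ = |S i j| * ‖v‖ ^ 2 := by ring

theorem dotProduct_vecMulVec_mulVec {d : ℕ} (a b v : Fin d → ℝ) :
    v ⬝ᵥ (vecMulVec a b *ᵥ v) = (v ⬝ᵥ a) * (b ⬝ᵥ v) := by
  rw [dotProduct_mulVec_eq_sum, dotProduct, dotProduct, Finset.sum_mul_sum]
  simp only [vecMulVec_apply]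
  refine Finset.sum_congr rfl fun i _ => Finset.sum_congr rfl fun j _ => by ring

theorem abs_dotProduct_le_norm {d : ℕ} (v w : Fin d → ℝ) : |v ⬝ᵥ w| ≤ d * (‖v‖ * ‖w‖) := by
  refine (Finset.abs_sum_le_sum_abs _ _).trans ?_
  refine (Finset.sum_le_card_nsmul _ _ (‖v‖ * ‖w‖) fun i _ => ?_).trans (by simp)
  rw [abs_mul]
  exact mul_le_mul (norm_le_pi_norm v i) (norm_le_pi_norm w i) (abs_nonneg _) (norm_nonneg _)

/-- A matrix whose quadratic form is at most `-κ ‖v‖²` has a pseudo-inverse bounded in terms of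
`κ`. -/
theorem norm_pinv_mulVec_le {d : ℕ} {A : Matrix (Fin d) (Fin d) ℝ} {κ : ℝ} (hκ : 0 < κ)
    (hA : ∀ v : Fin d → ℝ, v ⬝ᵥ (A *ᵥ v) ≤ -(κ * ‖v‖ ^ 2)) (w : Fin d → ℝ) :
    ‖pinv A *ᵥ w‖ ≤ d / κ * ‖w‖ := by
  have hinj : ∀ v, A *ᵥ v = 0 → v = 0 := by
    intro v hv
    have h := hA v
    rw [hv, dotProduct_zero] at h
    have : ‖v‖ ^ 2 ≤ 0 := by nlinarith [sq_nonneg ‖v‖]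
    exact norm_eq_zero.1 (pow_eq_zero_iff two_ne_zero |>.1 (le_antisymm this (sq_nonneg _)))
  have hBA : pinv A * A = 1 := by
    refine Matrix.ext_of_mulVec_single fun i => ?_
    rw [← sub_eq_zero, ← Matrix.sub_mulVec]
    apply hinj
    rw [Matrix.mulVec_mulVec, Matrix.mul_sub, Matrix.mul_one, ← Matrix.mul_assoc,
      (pinv_spec A).mul_mul_left, sub_self, Matrix.zero_mulVec]
  have hAB : A * pinv A = 1 := mul_eq_one_comm.1 hBA
  obtain ⟨v, hv⟩ : ∃ v, v = pinv A *ᵥ w := ⟨_, rfl⟩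
  have hAv : A *ᵥ v = w := by rw [hv, Matrix.mulVec_mulVec, hAB, Matrix.one_mulVec]
  rw [← hv]
  have h1 := hA v
  rw [hAv] at h1
  have h2 := (abs_le.1 (abs_dotProduct_le_norm v w)).1
  rcases (norm_nonneg v).eq_or_lt with h0 | h0
  · rw [← h0]; positivity
  · have h3 : κ * ‖v‖ ≤ d * ‖w‖ := by
      have : ‖v‖ * (κ * ‖v‖) ≤ ‖v‖ * (d * ‖w‖) := by nlinarith
      exact le_of_mul_le_mul_left this h0
    rw [div_mul_eq_mul_div, le_div_iff₀ hκ]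
    linarith

/-! ### Regularity of the stopping indicators in the parameter -/

/-- The intersection of a cube with the slab `|u ⬝ z - 1| ≤ δ` has volume of order `δ`. The shear
replacing the coordinate `z i` by `u ⬝ z` has determinant `u i` and maps it into a box. -/
theorem volume_slab_le {d : ℕ} (u : Fin d → ℝ) {i : Fin d} (hu : u i ≠ 0) {b δ : ℝ} (hb : 0 ≤ b)
    (hδ : 0 ≤ δ) :
    volume {z : Fin d → ℝ | ‖z‖ ≤ b ∧ |u ⬝ᵥ z - 1| ≤ δ} ≤
      ENNReal.ofReal (|(u i)⁻¹| * (2 * δ * (2 * b) ^ (d - 1))) := by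
  classical
  let f : (Fin d → ℝ) →ₗ[ℝ] (Fin d → ℝ) := Matrix.toLin' ((1 : Matrix _ _ ℝ).updateRow i u)
  have hf : ∀ z j, f z j = if j = i then u ⬝ᵥ z else z j := by
    intro z j
    rw [Matrix.toLin'_apply]
    by_cases h : j = i
    · subst h
      simp [Matrix.mulVec]
    · simp [Matrix.mulVec, h, Matrix.updateRow_ne, Matrix.one_eq_pi_single]
  have hdet : LinearMap.det f = u i := by
    rw [LinearMap.det_toLin', ← Matrix.cramer_transpose_apply]
    simp
  have hsub : {z : Fin d → ℝ | ‖z‖ ≤ b ∧ |u ⬝ᵥ z - 1| ≤ δ} ⊆ f ⁻¹' Set.Icc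
      (Function.update (fun _ => -b) i (1 - δ)) (Function.update (fun _ => b) i (1 + δ)) := by
    rintro z ⟨hz, hz'⟩
    have h1 := abs_le.1 hz'
    rw [Set.mem_preimage, Set.mem_Icc, Pi.le_def, Pi.le_def, ← forall_and]
    intro j
    rw [hf]
    by_cases h : j = i
    · subst h
      simp only [Function.update_self, if_true]
      constructor <;> linarith
    · have h2 := abs_le.1 ((norm_le_pi_norm z j).trans hz)
      simpa [h] using h2
  refine (measure_mono hsub).trans ?_
  rw [Measure.addHaar_preimage_linearMap _ (by rwa [hdet]), hdet, Real.volume_Icc_pi,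
    ENNReal.ofReal_mul (abs_nonneg _), ← ENNReal.ofReal_prod_of_nonneg]
  · gcongr
    apply le_of_eq
    have : (fun j => Function.update (fun _ : Fin d => b) i (1 + δ) j
        - Function.update (fun _ : Fin d => -b) i (1 - δ) j) =
        Function.update (fun _ => 2 * b) i (2 * δ) := by
      ext j
      by_cases h : j = i
      · subst h; simp; ring
      · simp [h]; ring
    rw [this, Finset.prod_update_of_mem (Finset.mem_univ i), Finset.prod_const,
      Finset.card_sdiff_of_subset (Finset.subset_univ _)]
    simp
  · intro j _
    by_cases h : j = i
    · subst h; simp; linarith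
    · simp [h]; linarith

namespace StoppingProblem

variable {m d : ℕ} {M : StoppingProblem m d}

theorem measurable_Q (hψ : Measurable M.ψ) :
    Measurable fun p : (Fin d → ℝ) × M.S => M.Q p.1 p.2 := by
  unfold Q dotProduct
  exact Finset.measurable_fun_sum _ fun i _ => ((measurable_pi_apply i).comp measurable_fst).mul
    ((measurable_pi_apply i).comp (hψ.comp measurable_snd))

theorem measurable_contInd (hψ : Measurable M.ψ) (hcs : Measurable M.cs) :
    Measurable fun p : (Fin d → ℝ) × M.S => M.contInd p.1 p.2 :=
  Measurable.ite (measurableSet_lt (measurable_Q hψ) (hcs.comp measurable_snd))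
    measurable_const measurable_const

theorem stopInd_eq (θ : Fin d → ℝ) (x : M.S) : M.stopInd θ x = 1 - M.contInd θ x := by
  unfold stopInd contInd
  rcases lt_or_ge (M.Q θ x) (M.cs x) with h | h
  · rw [if_neg (not_le.2 h), if_pos h, sub_self]
  · rw [if_pos h, if_neg (not_lt.2 h), sub_zero]

theorem contInd_nonneg (θ : Fin d → ℝ) (x : M.S) : 0 ≤ M.contInd θ x := by
  unfold contInd; split_ifs <;> norm_num

theorem contInd_le_one (θ : Fin d → ℝ) (x : M.S) : M.contInd θ x ≤ 1 := by
  unfold contInd; split_ifs <;> norm_num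

theorem gaussianDensity_le (μ z : Fin d → ℝ) :
    gaussianDensity μ z ≤ (√(2 * Real.pi))⁻¹ ^ d := by
  unfold gaussianDensity
  refine mul_le_of_le_one_right (by positivity) (Real.exp_le_one_iff.2 ?_)
  have : 0 ≤ (z - μ) ⬝ᵥ (z - μ) := Finset.sum_nonneg fun i _ => mul_self_nonneg _
  linarith

theorem gaussianDensity_nonneg (μ z : Fin d → ℝ) : 0 ≤ gaussianDensity μ z := by
  unfold gaussianDensity
  positivity

theorem TerminalCostInSpan.exists_eq (h : M.TerminalCostInSpan) :
    ∃ w : Fin d → ℝ, ∀ x, M.cs x = 1 + w ⬝ᵥ M.ψ x := by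
  obtain ⟨w, hw⟩ := (Submodule.mem_span_range_iff_exists_fun ℝ).1 h
  refine ⟨w, fun x => ?_⟩
  have := congrFun hw x
  simp only [Finset.sum_apply, Pi.smul_apply, smul_eq_mul] at this
  rw [dotProduct]
  linarith

/-- The probability that two parameters lead to different stopping decisions in the next state is
Lipschitz in the parameter. As `c_s = 1 + w ⬝ ψ`, the decisions differ only if `ψ(y)` lies in a thin
slab around the hyperplane `(θ - w) ⬝ z = 1`. The slab is close to empty or misses the support of
the law of `ψ(y)` unless `θ - w` is bounded away from zero, and then the bounded density applies. -/
theorem HasBoundedLikelihoodRatio.exists_lipschitz (hd : M.HasBoundedLikelihoodRatio)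
    (hs : M.TerminalCostInSpan) (hψ : Measurable M.ψ) (hcs : Measurable M.cs)
    (hP : IsMarkovKernel M.P) {b : ℝ} (hb : ∀ x, ‖M.ψ x‖ ≤ b) :
    ∃ K : ℝ, ∀ θ θ' x, ∫ y, |M.contInd θ y - M.contInd θ' y| ∂(M.P x) ≤ K * ‖θ - θ'‖ := by
  obtain ⟨ℓ, L, hℓ⟩ := hd
  obtain ⟨w, hw⟩ := hs.exists_eq
  -- if every coordinate of `θ - w` is at most `r`, then `|(θ - w) ⬝ z| ≤ 1 / 2` for `‖z‖ ≤ b`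
  obtain ⟨r, hr⟩ : ∃ r, r = 1 / (2 * (d * b) + 1) := ⟨_, rfl⟩
  obtain ⟨G, hG⟩ : ∃ G, G = (√(2 * Real.pi))⁻¹ ^ d := ⟨_, rfl⟩
  have hG0 : 0 ≤ G := by rw [hG]; positivity
  refine ⟨2 * (d * b) + L * G * (r⁻¹ * (2 * (d * b) * (2 * b) ^ (d - 1))), fun θ θ' x => ?_⟩
  have hb0 : 0 ≤ b := (norm_nonneg _).trans (hb x)
  have hdb : 0 ≤ d * b := by positivity
  have hr0 : 0 < r := by rw [hr]; positivity
  have hL : 0 ≤ L := ((hℓ x).2.1 0).1.trans ((hℓ x).2.1 0).2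
  obtain ⟨δ, hδ⟩ : ∃ δ, δ = d * b * ‖θ - θ'‖ := ⟨_, rfl⟩
  have hδ0 : 0 ≤ δ := by rw [hδ]; positivity
  have hdiff : ∀ y, M.contInd θ y ≠ M.contInd θ' y → |(θ - w) ⬝ᵥ M.ψ y - 1| ≤ δ := by
    intro y hy
    have h1 : |(θ - θ') ⬝ᵥ M.ψ y| ≤ δ := by
      refine (abs_dotProduct_le_norm _ _).trans ?_
      rw [hδ]
      have := mul_le_mul_of_nonneg_left (hb y) (norm_nonneg (θ - θ'))
      have := mul_le_mul_of_nonneg_left this (Nat.cast_nonneg (α := ℝ) d)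
      linarith
    rw [sub_dotProduct] at h1 ⊢
    have h2 := abs_le.1 h1
    unfold contInd Q at hy
    rw [hw] at hy
    rw [abs_le]
    by_cases c1 : θ ⬝ᵥ M.ψ y < 1 + w ⬝ᵥ M.ψ y <;> by_cases c2 : θ' ⬝ᵥ M.ψ y < 1 + w ⬝ᵥ M.ψ y
    · simp [c1, c2] at hy
    · constructor <;> linarith
    · constructor <;> linarith
    · simp [c1, c2] at hy
  obtain ⟨N, hN⟩ : ∃ N : Set M.S, N = {y | M.contInd θ y ≠ M.contInd θ' y} := ⟨_, rfl⟩
  have hcm : ∀ θ, Measurable (M.contInd θ) := fun θ =>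
    (measurable_contInd hψ hcs).comp measurable_prodMk_left
  have hNm : MeasurableSet N := by
    rw [hN]; exact (measurableSet_eq_fun (hcm θ) (hcm θ')).compl
  have hle : ∫ y, |M.contInd θ y - M.contInd θ' y| ∂(M.P x) ≤ (M.P x).real N := by
    have e : (M.P x).real N = ∫ y, N.indicator 1 y ∂(M.P x) := (integral_indicator_one hNm).symm
    rw [e]
    have hab : ∀ y, |M.contInd θ y - M.contInd θ' y| ≤ 1 := fun y => abs_le.2
      ⟨by linarith [M.contInd_nonneg θ y, M.contInd_le_one θ' y],
        by linarith [M.contInd_nonneg θ' y, M.contInd_le_one θ y]⟩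
    refine integral_mono (integrable_of_forall_abs_le (B := 1)
      ((hcm θ).sub (hcm θ')).abs fun y => by rw [abs_abs]; exact hab y)
      ((integrable_const (1 : ℝ)).indicator hNm) fun y => ?_
    by_cases hy : y ∈ N
    · rw [Set.indicator_of_mem hy]; exact hab y
    · have : M.contInd θ y = M.contInd θ' y := by
        by_contra hne; exact hy (by rw [hN]; exact hne)
      simp [hy, this]
  refine hle.trans ?_
  have hK : 0 ≤ L * G * (r⁻¹ * (2 * (d * b) * (2 * b) ^ (d - 1))) * ‖θ - θ'‖ := by positivity
  by_cases hu : ∀ i, |(θ - w) i| ≤ r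
  · have hun : ‖θ - w‖ ≤ r := (pi_norm_le_iff_of_nonneg hr0.le).2 hu
    rcases lt_or_ge δ (1 / 2) with hδ2 | hδ2
    · have : N = ∅ := by
        rw [Set.eq_empty_iff_forall_notMem]
        intro y hy
        rw [hN] at hy
        have h1 := (abs_le.1 (hdiff y hy)).1
        have h2 : |(θ - w) ⬝ᵥ M.ψ y| ≤ d * (r * b) :=
          (abs_dotProduct_le_norm _ _).trans (mul_le_mul_of_nonneg_left
            (mul_le_mul hun (hb y) (norm_nonneg _) hr0.le) (Nat.cast_nonneg _))
        have h3 : d * (r * b) ≤ 1 / 2 := by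
          rw [hr, show (d : ℝ) * (1 / (2 * (d * b) + 1) * b) = (d * b) / (2 * (d * b) + 1) by ring,
            div_le_div_iff₀ (by positivity) (by norm_num)]
          linarith
        linarith [(abs_le.1 h2).2]
      rw [this, measureReal_empty, add_mul]
      have : 0 ≤ 2 * (d * b) * ‖θ - θ'‖ := by positivity
      linarith
    -- here `‖θ - θ'‖` is bounded below, and the trivial bound `1 ≤ 2 δ` is enough
    · have h1 : (M.P x).real N ≤ 1 := measureReal_le_one
      rw [add_mul]
      linarith
  · push Not at hu
    obtain ⟨i, hi⟩ := hu
    have hui : (θ - w) i ≠ 0 := abs_pos.1 (hr0.trans hi)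
    obtain ⟨s, hs'⟩ : ∃ s, s = {z : Fin d → ℝ | ‖z‖ ≤ b ∧ |(θ - w) ⬝ᵥ z - 1| ≤ δ} := ⟨_, rfl⟩
    have hsm : MeasurableSet s := by
      rw [hs']
      have hc : Continuous fun z : Fin d → ℝ => |(θ - w) ⬝ᵥ z - 1| :=
        ((continuous_const.dotProduct continuous_id).sub continuous_const).abs
      exact ((isClosed_le continuous_norm continuous_const).inter
        (isClosed_le hc continuous_const)).measurableSet
    have h1 : (M.P x) N ≤ ENNReal.ofReal
        (L * G * (|((θ - w) i)⁻¹| * (2 * δ * (2 * b) ^ (d - 1)))) :=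
      calc (M.P x) N ≤ (M.P x) (M.ψ ⁻¹' s) := measure_mono fun y hy => by
            rw [hN] at hy
            rw [hs']
            exact ⟨hb y, hdiff y hy⟩
        _ = ∫⁻ z in s, ENNReal.ofReal (ℓ x z * gaussianDensity (M.ψ x) z) := by
            rw [← Measure.map_apply hψ hsm, (hℓ x).2.2, withDensity_apply _ hsm]
        _ ≤ ∫⁻ _ in s, ENNReal.ofReal (L * G) := by
            refine lintegral_mono fun z => ENNReal.ofReal_le_ofReal ?_
            refine mul_le_mul ((hℓ x).2.1 z).2 ?_ (gaussianDensity_nonneg _ _) hL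
            rw [hG]; exact gaussianDensity_le _ _
        _ = ENNReal.ofReal (L * G) * volume s := by
            rw [lintegral_const, Measure.restrict_apply_univ]
        _ ≤ _ := by
            rw [ENNReal.ofReal_mul (p := L * G) (by positivity)]
            refine mul_le_mul' le_rfl ?_
            rw [hs']
            exact volume_slab_le _ hui hb0 hδ0
    have h2 : (M.P x).real N ≤ L * G * (|((θ - w) i)⁻¹| * (2 * δ * (2 * b) ^ (d - 1))) :=
      ENNReal.toReal_le_of_le_ofReal (by positivity) h1
    have h3 : |((θ - w) i)⁻¹| ≤ r⁻¹ := by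
      rw [abs_inv]
      exact inv_anti₀ hr0 hi.le
    have h4 : L * G * (|((θ - w) i)⁻¹| * (2 * δ * (2 * b) ^ (d - 1))) ≤
        L * G * (r⁻¹ * (2 * δ * (2 * b) ^ (d - 1))) := by gcongr
    have h5 : 0 ≤ 2 * (d * b) * ‖θ - θ'‖ := by positivity
    rw [hδ] at h4 h2
    rw [add_mul]
    have h6 : L * G * (r⁻¹ * (2 * (d * b * ‖θ - θ'‖) * (2 * b) ^ (d - 1))) =
        L * G * (r⁻¹ * (2 * (d * b) * (2 * b) ^ (d - 1))) * ‖θ - θ'‖ := by ring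
    linarith

/-! ### The step sizes -/

theorem gammaStep_nonneg (ϱ : ℝ) (n : ℕ) : 0 ≤ gammaStep ϱ n := by
  unfold gammaStep; positivity

theorem gammaStep_succ_le_one {ϱ : ℝ} (h : 0 ≤ ϱ) (n : ℕ) : gammaStep ϱ (n + 1) ≤ 1 := by
  unfold gammaStep
  have h1 : (1 : ℝ) ≤ ((n + 1 : ℕ) : ℝ) := by exact_mod_cast Nat.succ_pos n
  have := Real.one_le_rpow h1 h
  rw [div_le_one (by linarith)]
  exact this

theorem antitone_gammaStep_succ {ϱ : ℝ} (h : 0 ≤ ϱ) :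
    Antitone fun k : ℕ => gammaStep ϱ (k + 1) := by
  intro k l hkl
  unfold gammaStep
  have h1 : (0 : ℝ) < ((k + 1 : ℕ) : ℝ) := by positivity
  refine one_div_le_one_div_of_le (Real.rpow_pos_of_pos h1 _) (Real.rpow_le_rpow h1.le ?_ h)
  exact_mod_cast Nat.succ_le_succ hkl

theorem tendsto_gammaStep_succ {ϱ : ℝ} (h : 0 < ϱ) :
    Tendsto (fun k : ℕ => gammaStep ϱ (k + 1)) atTop (𝓝 0) := by
  have : Tendsto (fun k : ℕ => gammaStep ϱ k) atTop (𝓝 0) := by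
    unfold gammaStep
    simp only [one_div]
    exact ((tendsto_rpow_atTop h).comp tendsto_natCast_atTop_atTop).inv_tendsto_atTop
  exact this.comp (tendsto_add_atTop_nat 1)

theorem summable_gammaStep_succ_sq {ϱ : ℝ} (h : 1 / 2 < ϱ) :
    Summable fun k : ℕ => gammaStep ϱ (k + 1) ^ 2 := by
  have h1 : Summable fun k : ℕ => gammaStep ϱ k ^ 2 := by
    refine (Real.summable_one_div_nat_rpow.2 (by linarith : 1 < ϱ * 2)).congr fun k => ?_
    unfold gammaStep
    rw [div_pow, one_pow, Real.rpow_mul (Nat.cast_nonneg _), Real.rpow_two]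
  exact (summable_nat_add_iff 1).2 h1

theorem not_summable_gammaStep_succ {ϱ : ℝ} (h : ϱ < 1) :
    ¬ Summable fun k : ℕ => gammaStep ϱ (k + 1) := by
  intro hs
  have h1 := (summable_nat_add_iff 1).1 hs
  exact absurd (Real.summable_one_div_nat_rpow.1 h1) (not_lt.2 h.le)

theorem summable_gammaStep_mul_alphaStep {ϱ : ℝ} (h : 0 < ϱ) :
    Summable fun k : ℕ => gammaStep ϱ (k + 1) * alphaStep (k + 1) := by
  have h1 : Summable fun k : ℕ => gammaStep ϱ k * alphaStep k := by
    refine (Real.summable_one_div_nat_rpow.2 (by linarith : 1 < ϱ + 1)).congr fun k => ?_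
    unfold gammaStep alphaStep
    rw [div_mul_div_comm, one_mul, Real.rpow_add_one' (Nat.cast_nonneg _) (by linarith)]
  exact (summable_nat_add_iff 1).2 h1

/-! ### The chain and the Zap-Q iterates -/

theorem IsMarkovChain.markovRel {Ω : Type*} [MeasurableSpace Ω] {Pr : Measure Ω}
    {X : ℕ → Ω → M.S} {hX : ∀ n, Measurable (X n)} (h : M.IsMarkovChain Pr X hX) :
    MarkovRel Pr (chainFiltration X hX) M.P X where
  adapted n :=
    (Filtration.stronglyAdapted_natural fun n => (hX n).stronglyMeasurable) n |>.measurable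
  condProb V hV n := by
    have := h (V.indicator fun _ => (1 : ℝ)) (measurable_const.indicator hV)
      ⟨1, fun x => by
        by_cases hx : x ∈ V <;> simp [hx]⟩ n
    refine this.trans (ae_of_all _ fun ω => ?_)
    simp only [integral_indicator_const _ hV, smul_eq_mul, mul_one]

theorem UniformlyErgodic.exists_geomErgodic {π : Measure M.S} (h : M.UniformlyErgodic π) :
    ∃ D ρ, GeomErgodic M.P π D ρ := by
  obtain ⟨D, ρ, h0, h1, h2⟩ := h.geometric
  exact ⟨D, ρ, h0, h1, h2⟩

section Zap

variable {Ω : Type*} (ϱ : ℝ) (θ₀ : Fin d → ℝ) (A₀ : Matrix (Fin d) (Fin d) ℝ)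
  (X : ℕ → Ω → M.S)

theorem zapA_succ (n : ℕ) (ω : Ω) : M.zapA ϱ θ₀ A₀ X (n + 1) ω = M.zapA ϱ θ₀ A₀ X n ω +
    gammaStep ϱ (n + 1) • (M.sampleA (M.zapTheta ϱ θ₀ A₀ X n ω) (X n ω) (X (n + 1) ω)
      - M.zapA ϱ θ₀ A₀ X n ω) := rfl

theorem zapTheta_succ (n : ℕ) (ω : Ω) : M.zapTheta ϱ θ₀ A₀ X (n + 1) ω =
    M.zapTheta ϱ θ₀ A₀ X n ω - alphaStep (n + 1) • (pinv (M.zapA ϱ θ₀ A₀ X (n + 1) ω) *ᵥ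
      (M.tempDiff (M.zapTheta ϱ θ₀ A₀ X n ω) (X n ω) (X (n + 1) ω) • M.ψ (X n ω))) := rfl

end Zap

theorem sampleA_apply (θ : Fin d → ℝ) (x y : M.S) (i j : Fin d) :
    M.sampleA θ x y i j = -(M.ψ x i * M.ψ x j) + M.β * M.ψ x i * M.ψ y j * M.contInd θ y := by
  simp only [sampleA, vecMulVec_apply, Pi.sub_apply, Pi.smul_apply, smul_eq_mul]
  ring

theorem measurable_tempDiff (hM : M.IsRegular) :
    Measurable fun q : ((Fin d → ℝ) × M.S) × M.S => M.tempDiff q.1.1 q.1.2 q.2 := by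
  unfold tempDiff
  have hQ := measurable_Q hM.measurable_psi
  exact ((hM.measurable_c.comp (measurable_snd.comp measurable_fst)).add
    (measurable_const.mul ((hM.measurable_cs.comp measurable_snd).min
      (hQ.comp ((measurable_fst.comp measurable_fst).prodMk measurable_snd))))).sub
    (hQ.comp measurable_fst)

theorem measurable_psi_apply (hM : M.IsRegular) (i : Fin d) : Measurable fun x => M.ψ x i :=
  (measurable_pi_apply i).comp hM.measurable_psi

theorem measurable_sampleA (hM : M.IsRegular) (i j : Fin d) :
    Measurable fun q : ((Fin d → ℝ) × M.S) × M.S => M.sampleA q.1.1 q.1.2 q.2 i j := by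
  simp only [sampleA_apply]
  have h1 : ∀ i, Measurable fun q : ((Fin d → ℝ) × M.S) × M.S => M.ψ q.1.2 i := fun i =>
    (measurable_psi_apply hM i).comp (measurable_snd.comp measurable_fst)
  have h2 : Measurable fun q : ((Fin d → ℝ) × M.S) × M.S => M.ψ q.2 j :=
    (measurable_psi_apply hM j).comp measurable_snd
  have h3 : Measurable fun q : ((Fin d → ℝ) × M.S) × M.S => M.contInd q.1.1 q.2 :=
    (measurable_contInd hM.measurable_psi hM.measurable_cs).comp
      ((measurable_fst.comp measurable_fst).prodMk measurable_snd)
  exact ((h1 i).mul (h1 j)).neg.add (((measurable_const.mul (h1 i)).mul h2).mul h3)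

/-- One step of the matrix recursion preserves measurability. Here and in the next lemma the
`σ`-algebra on `Ω` is arbitrary, so that members of a filtration can be used. -/
theorem measurable_zapA_step (hM : M.IsRegular) {Ω : Type*} {mΩ : MeasurableSpace Ω}
    {x y : Ω → M.S} {θ : Ω → Fin d → ℝ} {A : Ω → Matrix (Fin d) (Fin d) ℝ} (hx : Measurable x)
    (hy : Measurable y) (hθ : Measurable θ) (hA : Measurable fun ω => Matrix.of.symm (A ω))
    (γ : ℝ) :
    Measurable fun ω => Matrix.of.symm (A ω + γ • (M.sampleA (θ ω) (x ω) (y ω) - A ω)) := by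
  have hAij : ∀ i j, Measurable fun ω => A ω i j := fun i j =>
    (measurable_pi_apply j).comp ((measurable_pi_apply i).comp hA)
  refine measurable_pi_lambda _ fun i => measurable_pi_lambda _ fun j => ?_
  exact (hAij i j).add ((((measurable_sampleA hM i j).comp
    ((hθ.prodMk hx).prodMk hy)).sub (hAij i j)).const_mul _)

theorem measurable_zapTheta_step (hM : M.IsRegular) {Ω : Type*} {mΩ : MeasurableSpace Ω}
    {x y : Ω → M.S} {θ : Ω → Fin d → ℝ} {A : Ω → Matrix (Fin d) (Fin d) ℝ} (hx : Measurable x)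
    (hy : Measurable y) (hθ : Measurable θ) (hA : Measurable fun ω => Matrix.of.symm (A ω))
    (α : ℝ) :
    Measurable fun ω => θ ω - α • (pinv (A ω) *ᵥ
      (M.tempDiff (θ ω) (x ω) (y ω) • M.ψ (x ω))) := by
  refine measurable_pi_lambda _ fun i => ?_
  have hp := measurable_pinv.comp hA
  have hpij : ∀ j, Measurable fun ω => pinv (A ω) i j :=
    fun j => (measurable_pi_apply j).comp ((measurable_pi_apply i).comp hp)
  have hsum : Measurable fun ω => ∑ j, pinv (A ω) i j *
      (M.tempDiff (θ ω) (x ω) (y ω) * M.ψ (x ω) j) :=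
    Finset.measurable_fun_sum _ fun j _ => (hpij j).mul
      (((measurable_tempDiff hM).comp ((hθ.prodMk hx).prodMk hy)).mul
        ((measurable_psi_apply hM j).comp hx))
  exact ((measurable_pi_apply i).comp hθ).sub (hsum.const_mul _)

/-- The Zap-Q iterates are adapted to the filtration of the chain. -/
theorem measurable_zap (hM : M.IsRegular) {Ω : Type*} [mΩ : MeasurableSpace Ω]
    {ℱ : Filtration ℕ mΩ} {X : ℕ → Ω → M.S} (hX : ∀ n, Measurable[ℱ n] (X n)) (ϱ : ℝ)
    (θ₀ : Fin d → ℝ) (A₀ : Matrix (Fin d) (Fin d) ℝ) (n : ℕ) :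
    Measurable[ℱ n] (M.zapTheta ϱ θ₀ A₀ X n) ∧
      Measurable[ℱ n] fun ω => Matrix.of.symm (M.zapA ϱ θ₀ A₀ X n ω) := by
  induction n with
  | zero => exact ⟨measurable_const, measurable_const⟩
  | succ n ih =>
    have hθ := ih.1.mono (ℱ.mono n.le_succ) le_rfl
    have hA := ih.2.mono (ℱ.mono n.le_succ) le_rfl
    have hx := (hX n).mono (ℱ.mono n.le_succ) le_rfl
    have hA' := measurable_zapA_step hM hx (hX (n + 1)) hθ hA (gammaStep ϱ (n + 1))
    exact ⟨measurable_zapTheta_step hM hx (hX (n + 1)) hθ hA' (alphaStep (n + 1)), hA'⟩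

/-! ### The matrix iterates are eventually coercive -/

theorem integrable_psi_mul_psi (hM : M.IsRegular) (π : Measure M.S) [IsProbabilityMeasure π]
    (i j : Fin d) : Integrable (fun x => M.ψ x i * M.ψ x j) π := by
  obtain ⟨b, hb⟩ := hM.bounded_psi
  refine integrable_of_forall_abs_le ((measurable_psi_apply hM i).mul (measurable_psi_apply hM j))
    (B := b * b) fun x => ?_
  rw [abs_mul]
  have h : ∀ i, |M.ψ x i| ≤ b := fun i => (norm_le_pi_norm _ i).trans (hb x)
  exact mul_le_mul (h i) (h j) (abs_nonneg _) ((abs_nonneg _).trans (h i))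

theorem covariance_mulVec_apply (hM : M.IsRegular) (π : Measure M.S) [IsProbabilityMeasure π]
    (v : Fin d → ℝ) (i : Fin d) :
    (M.covariance π *ᵥ v) i = ∫ x, M.ψ x i * (M.ψ x ⬝ᵥ v) ∂π := by
  have : ∀ x, M.ψ x i * (M.ψ x ⬝ᵥ v) = ∑ j, M.ψ x i * M.ψ x j * v j := fun x => by
    simp only [dotProduct, Finset.mul_sum, mul_assoc]
  simp only [this]
  rw [integral_finsetSum _ fun j _ => (integrable_psi_mul_psi hM π i j).mul_const _]
  simp only [integral_mul_const, mulVec, dotProduct, covariance, Matrix.of_apply]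

theorem integrable_psi_mul_dotProduct (hM : M.IsRegular) (π : Measure M.S)
    [IsProbabilityMeasure π] (v : Fin d → ℝ) (i : Fin d) :
    Integrable (fun x => M.ψ x i * (M.ψ x ⬝ᵥ v)) π := by
  have : ∀ x, M.ψ x i * (M.ψ x ⬝ᵥ v) = ∑ j, M.ψ x i * M.ψ x j * v j := fun x => by
    simp only [dotProduct, Finset.mul_sum, mul_assoc]
  simp only [this]
  exact integrable_finsetSum _ fun j _ => (integrable_psi_mul_psi hM π i j).mul_const _

theorem dotProduct_covariance_mulVec (hM : M.IsRegular) (π : Measure M.S)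
    [IsProbabilityMeasure π] (v : Fin d → ℝ) :
    Integrable (fun x => (M.ψ x ⬝ᵥ v) ^ 2) π ∧
      v ⬝ᵥ (M.covariance π *ᵥ v) = ∫ x, (M.ψ x ⬝ᵥ v) ^ 2 ∂π := by
  have e : ∀ x, (M.ψ x ⬝ᵥ v) ^ 2 = ∑ i, v i * (M.ψ x i * (M.ψ x ⬝ᵥ v)) := fun x => by
    rw [sq]
    nth_rw 1 [dotProduct]
    rw [Finset.sum_mul]
    exact Finset.sum_congr rfl fun i _ => by ring
  simp only [e]
  refine ⟨integrable_finsetSum _ fun i _ => (integrable_psi_mul_dotProduct hM π v i).const_mul _,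
    ?_⟩
  rw [integral_finsetSum _ fun i _ => (integrable_psi_mul_dotProduct hM π v i).const_mul _]
  simp only [integral_const_mul, dotProduct, covariance_mulVec_apply hM]

/-- A nonsingular covariance matrix is coercive: if the quadratic form vanishes at `v`, then
`ψ ⬝ v = 0` almost everywhere and hence `Σ v = 0`; compactness of the sphere does the rest. -/
theorem exists_covariance_coercive (hM : M.IsRegular) (π : Measure M.S) [IsProbabilityMeasure π]
    (hfull : IsUnit (M.covariance π)) :
    ∃ c : ℝ, 0 < c ∧ ∀ v : Fin d → ℝ, c * ‖v‖ ^ 2 ≤ v ⬝ᵥ (M.covariance π *ᵥ v) := by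
  have hpos : ∀ v : Fin d → ℝ, v ≠ 0 → 0 < v ⬝ᵥ (M.covariance π *ᵥ v) := by
    intro v hv
    obtain ⟨hi, he⟩ := dotProduct_covariance_mulVec hM π v
    rw [he]
    refine lt_of_le_of_ne (integral_nonneg fun x => sq_nonneg _) fun h0 => hv ?_
    have hae := (integral_eq_zero_iff_of_nonneg (fun x => sq_nonneg (M.ψ x ⬝ᵥ v)) hi).1 h0.symm
    have hz : M.covariance π *ᵥ v = 0 := by
      ext i
      rw [covariance_mulVec_apply hM]
      refine (integral_congr_ae ?_).trans (integral_zero _ _)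
      filter_upwards [hae] with x hx
      have : M.ψ x ⬝ᵥ v = 0 := pow_eq_zero_iff two_ne_zero |>.1 hx
      rw [this, mul_zero]
    exact Matrix.mulVec_injective_of_isUnit hfull (by rw [hz, Matrix.mulVec_zero])
  have hcont : Continuous fun v : Fin d → ℝ => v ⬝ᵥ (M.covariance π *ᵥ v) :=
    continuous_id.dotProduct (continuous_const.matrix_mulVec continuous_id)
  -- the sphere is empty exactly when `d = 0`
  rcases (Metric.sphere (0 : Fin d → ℝ) 1).eq_empty_or_nonempty with hs | hs
  · refine ⟨1, one_pos, fun v => ?_⟩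
    have hv : v = 0 := by
      by_contra hv
      have : ‖v‖⁻¹ • v ∈ Metric.sphere (0 : Fin d → ℝ) 1 := by
        rw [mem_sphere_zero_iff_norm, norm_smul, norm_inv, norm_norm,
          inv_mul_cancel₀ (norm_ne_zero_iff.2 hv)]
      rw [hs] at this
      exact this
    simp [hv]
  · obtain ⟨v₀, hv₀, hmin⟩ := (isCompact_sphere (0 : Fin d → ℝ) 1).exists_isMinOn hs
      hcont.continuousOn
    refine ⟨_, hpos v₀ (ne_zero_of_mem_unit_sphere ⟨v₀, hv₀⟩), fun v => ?_⟩
    rcases eq_or_ne v 0 with rfl | hv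
    · simp
    have hn : ‖v‖ ≠ 0 := norm_ne_zero_iff.2 hv
    have hmem : ‖v‖⁻¹ • v ∈ Metric.sphere (0 : Fin d → ℝ) 1 := by
      rw [mem_sphere_zero_iff_norm, norm_smul, norm_inv, norm_norm, inv_mul_cancel₀ hn]
    have h1 := isMinOn_iff.1 hmin _ hmem
    rw [mulVec_smul, dotProduct_smul, smul_dotProduct, smul_eq_mul, smul_eq_mul] at h1
    calc v₀ ⬝ᵥ (M.covariance π *ᵥ v₀) * ‖v‖ ^ 2
        ≤ ‖v‖⁻¹ * (‖v‖⁻¹ * (v ⬝ᵥ (M.covariance π *ᵥ v))) * ‖v‖ ^ 2 :=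
          mul_le_mul_of_nonneg_right h1 (sq_nonneg _)
      _ = v ⬝ᵥ (M.covariance π *ᵥ v) := by field_simp

/-- A symmetric matrix, not depending on the parameter, whose quadratic form dominates that of the
sample matrix `ψ(x) [β 𝒮_θ ψ(y) - ψ(x)]ᵀ`. -/
def dominating (M : StoppingProblem m d) (x y : M.S) : Matrix (Fin d) (Fin d) ℝ :=
  (-(1 - M.β / 2)) • vecMulVec (M.ψ x) (M.ψ x) + (M.β / 2) • vecMulVec (M.ψ y) (M.ψ y)

theorem dominating_apply (x y : M.S) (i j : Fin d) : M.dominating x y i j =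
    -(1 - M.β / 2) * (M.ψ x i * M.ψ x j) + M.β / 2 * (M.ψ y i * M.ψ y j) := rfl

theorem sampleA_le_dominating (hM : M.IsRegular) (θ : Fin d → ℝ) (x y : M.S) (v : Fin d → ℝ) :
    v ⬝ᵥ (M.sampleA θ x y *ᵥ v) ≤ v ⬝ᵥ (M.dominating x y *ᵥ v) := by
  have hβ := hM.beta_pos
  simp only [sampleA, dominating, add_mulVec, smul_mulVec, dotProduct_add, dotProduct_smul,
    dotProduct_vecMulVec_mulVec, sub_dotProduct, smul_dotProduct, smul_eq_mul,
    dotProduct_comm (M.ψ _) v]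
  have h : M.contInd θ y = 0 ∨ M.contInd θ y = 1 := by
    unfold contInd; split_ifs <;> simp
  -- Young's inequality for the cross term
  rcases h with h | h <;> rw [h] <;>
    nlinarith [mul_nonneg hβ.le (sq_nonneg (v ⬝ᵥ M.ψ x - v ⬝ᵥ M.ψ y)),
      mul_nonneg hβ.le (sq_nonneg (v ⬝ᵥ M.ψ x)), mul_nonneg hβ.le (sq_nonneg (v ⬝ᵥ M.ψ y))]

theorem abs_psi_apply_le {b : ℝ} (hb : ∀ x, ‖M.ψ x‖ ≤ b) (x : M.S) (i : Fin d) : |M.ψ x i| ≤ b :=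
  (norm_le_pi_norm _ i).trans (hb x)

theorem abs_psi_mul_psi_le {b : ℝ} (hb : ∀ x, ‖M.ψ x‖ ≤ b) (x : M.S) (i j : Fin d) :
    |M.ψ x i * M.ψ x j| ≤ b * b := by
  rw [abs_mul]
  exact mul_le_mul (abs_psi_apply_le hb x i) (abs_psi_apply_le hb x j) (abs_nonneg _)
    ((abs_nonneg _).trans (abs_psi_apply_le hb x i))

theorem integral_dominating (hM : M.IsRegular) (hP : IsMarkovKernel M.P) {π : Measure M.S}
    [IsProbabilityMeasure π] (hinv : M.P.Invariant π) (i j : Fin d) :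
    ∫ p, M.dominating p.1 p.2 i j ∂(π ⊗ₘ M.P) = -(1 - M.β) * M.covariance π i j := by
  obtain ⟨b, hb⟩ := hM.bounded_psi
  have hm : Measurable fun x => M.ψ x i * M.ψ x j :=
    (measurable_psi_apply hM i).mul (measurable_psi_apply hM j)
  have h1 : ∫ p, M.ψ p.1 i * M.ψ p.1 j ∂(π ⊗ₘ M.P) = M.covariance π i j := by
    have := integral_map (μ := π ⊗ₘ M.P) measurable_fst.aemeasurable
      (f := fun x => M.ψ x i * M.ψ x j) hm.aestronglyMeasurable
    rw [← this]
    change ∫ x, M.ψ x i * M.ψ x j ∂(π ⊗ₘ M.P).fst = _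
    rw [Measure.fst_compProd]
    rfl
  have h2 : ∫ p, M.ψ p.2 i * M.ψ p.2 j ∂(π ⊗ₘ M.P) = M.covariance π i j := by
    have := integral_map (μ := π ⊗ₘ M.P) measurable_snd.aemeasurable
      (f := fun x => M.ψ x i * M.ψ x j) hm.aestronglyMeasurable
    rw [← this]
    change ∫ x, M.ψ x i * M.ψ x j ∂(π ⊗ₘ M.P).snd = _
    rw [Measure.snd_compProd, hinv]
    rfl
  simp only [dominating_apply]
  rw [integral_add, integral_const_mul, integral_const_mul, h1, h2]
  · ring
  · exact (integrable_of_forall_abs_le (hm.comp measurable_fst)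
      fun p => abs_psi_mul_psi_le hb p.1 i j).const_mul _
  · exact (integrable_of_forall_abs_le (hm.comp measurable_snd)
      fun p => abs_psi_mul_psi_le hb p.2 i j).const_mul _

/-- Averages of the centred dominating matrices along the chain tend to zero. -/
theorem ae_tendsto_averaged_dominating (hM : M.IsRegular) {π : Measure M.S}
    (hergodic : M.UniformlyErgodic π) {Ω : Type*} [MeasurableSpace Ω] {Pr : Measure Ω}
    [IsProbabilityMeasure Pr] {X : ℕ → Ω → M.S} {hX : ∀ n, Measurable (X n)}
    (hchain : M.IsMarkovChain Pr X hX) {ϱ : ℝ} (hϱ : 1 / 2 < ϱ) (hϱ' : ϱ < 1)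
    (S₀ : Matrix (Fin d) (Fin d) ℝ) :
    ∀ᵐ ω ∂Pr, ∀ i j, Tendsto (fun n => averaged (fun n => gammaStep ϱ (n + 1))
      (fun n => M.dominating (X n ω) (X (n + 1) ω) + (1 - M.β) • M.covariance π) S₀ n i j)
      atTop (𝓝 0) := by
  have hP := hM.markov
  have hπ := hergodic.prob
  obtain ⟨D, ρ, hgeo⟩ := hergodic.exists_geomErgodic
  obtain ⟨b, hb⟩ := hM.bounded_psi
  refine ae_all_iff.2 fun i => ae_all_iff.2 fun j => ?_
  have hm : Measurable fun x => M.ψ x i * M.ψ x j :=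
    (measurable_psi_apply hM i).mul (measurable_psi_apply hM j)
  let E : ℕ → Ω → ℝ := fun k ω => Nat.casesOn k 0 fun n =>
    M.dominating (X n ω) (X (n + 1) ω) i j - ∫ p, M.dominating p.1 p.2 i j ∂(π ⊗ₘ M.P)
  have hE : ODEFriendly Pr (chainFiltration X hX) (gammaStep ϱ) E := by
    refine hchain.markovRel.odeFriendly (π := π) hgeo (Θ := Unit)
      (h := fun _ x y => M.dominating x y i j)
      (B := |-(1 - M.β / 2)| * (b * b) + |M.β / 2| * (b * b)) (K := 0) (θ := fun _ _ => ())
      ?_ ?_ ?_ ?_ (gammaStep_nonneg ϱ) ?_ ?_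
    · simp only [dominating_apply]
      exact ((hm.comp (measurable_snd.comp measurable_fst)).const_mul _).add
        ((hm.comp measurable_snd).const_mul _)
    · intro _ x y
      rw [dominating_apply]
      refine (abs_add_le _ _).trans (add_le_add ?_ ?_) <;> rw [abs_mul] <;>
        exact mul_le_mul_of_nonneg_left (abs_psi_mul_psi_le hb _ i j) (abs_nonneg _)
    · intro _ _ x
      simp
    · exact fun n => measurable_const
    · exact ae_of_all _ fun ω => by simp
    · exact fun n ω => rfl
  filter_upwards [hE.ae_exists_tendsto_sum (antitone_gammaStep_succ (by linarith))
    (tendsto_gammaStep_succ (by linarith)) (summable_gammaStep_succ_sq hϱ)] with ω ⟨l, hl⟩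
  refine tendsto_zero_of_tendsto_sum (γ := fun n => gammaStep ϱ (n + 1))
    (e := fun n => E (n + 1) ω) (fun n => gammaStep_nonneg ϱ _)
    (fun n => gammaStep_succ_le_one (by linarith) n) (not_summable_gammaStep_succ hϱ') hl
    fun n => ?_
  simp only [E]
  rw [integral_dominating hM hP hergodic.invariant]
  simp only [averaged, Matrix.add_apply, Matrix.smul_apply, Matrix.sub_apply, smul_eq_mul]
  ring

/-- Almost surely the matrix iterates are eventually uniformly negative definite, whatever the
behaviour of the parameter: they are dominated by averages of matrices that do not involve it, and
these averages converge to `-(1 - β) Σ`. -/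
theorem ae_exists_zapA_coercive (hM : M.IsRegular) {π : Measure M.S}
    (hergodic : M.UniformlyErgodic π) (hfull : IsUnit (M.covariance π))
    {Ω : Type*} [MeasurableSpace Ω] {Pr : Measure Ω}
    [IsProbabilityMeasure Pr] {X : ℕ → Ω → M.S} {hX : ∀ n, Measurable (X n)}
    (hchain : M.IsMarkovChain Pr X hX) {ϱ : ℝ} (hϱ : 1 / 2 < ϱ) (hϱ' : ϱ < 1)
    (θ₀ : Fin d → ℝ) (A₀ : Matrix (Fin d) (Fin d) ℝ) :
    ∃ κ : ℝ, 0 < κ ∧ ∀ᵐ ω ∂Pr, ∀ᶠ n in atTop, ∀ v : Fin d → ℝ,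
      v ⬝ᵥ (M.zapA ϱ θ₀ A₀ X n ω *ᵥ v) ≤ -(κ * ‖v‖ ^ 2) := by
  have hπ := hergodic.prob
  have hβ := hM.beta_lt_one
  obtain ⟨c, hc, hcoer⟩ := exists_covariance_coercive hM π hfull
  have hκ : 0 < (1 - M.β) * c / 2 := half_pos (mul_pos (sub_pos.2 hβ) hc)
  refine ⟨(1 - M.β) * c / 2, hκ, ?_⟩
  filter_upwards [ae_tendsto_averaged_dominating hM hergodic hchain hϱ hϱ'
    (A₀ + (1 - M.β) • M.covariance π)] with ω hω
  obtain ⟨S, hS⟩ : ∃ S, S = averaged (fun n => gammaStep ϱ (n + 1))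
    (fun n => M.dominating (X n ω) (X (n + 1) ω) + (1 - M.β) • M.covariance π)
    (A₀ + (1 - M.β) • M.covariance π) := ⟨_, rfl⟩
  rw [← hS] at hω
  -- `S n - (1 - β) Σ` follows the recursion of `Â` with the sample matrices dominated
  have hdom : ∀ n v, v ⬝ᵥ (M.zapA ϱ θ₀ A₀ X n ω *ᵥ v) ≤
      v ⬝ᵥ (S n *ᵥ v) - (1 - M.β) * (v ⬝ᵥ (M.covariance π *ᵥ v)) := by
    intro n v
    induction n with
    | zero =>
      rw [hS]
      simp only [averaged, add_mulVec, smul_mulVec, dotProduct_add, dotProduct_smul, smul_eq_mul,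
        add_sub_cancel_right]
      exact le_rfl
    | succ n ih =>
      have h0 := gammaStep_nonneg ϱ (n + 1)
      have h1 := gammaStep_succ_le_one (by linarith : 0 ≤ ϱ) n
      have h2 := sampleA_le_dominating hM (M.zapTheta ϱ θ₀ A₀ X n ω) (X n ω) (X (n + 1) ω) v
      have hSn : S (n + 1) = S n + gammaStep ϱ (n + 1) •
          (M.dominating (X n ω) (X (n + 1) ω) + (1 - M.β) • M.covariance π - S n) := by
        rw [hS]; rfl
      rw [zapA_succ, hSn]
      simp only [add_mulVec, smul_mulVec, sub_mulVec, dotProduct_add, dotProduct_sub,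
        dotProduct_smul, smul_eq_mul]
      nlinarith [mul_le_mul_of_nonneg_left ih (sub_nonneg.2 h1), mul_le_mul_of_nonneg_left h2 h0]
  have hsum : Tendsto (fun n => ∑ i, ∑ j, |S n i j|) atTop (𝓝 0) := by
    have := tendsto_finsetSum (Finset.univ : Finset (Fin d)) fun i _ =>
      tendsto_finsetSum (Finset.univ : Finset (Fin d)) fun j _ => (hω i j).abs
    simpa using this
  filter_upwards [hsum.eventually (gt_mem_nhds hκ)] with n hn v
  have h1 := hdom n v
  have h2 := dotProduct_mulVec_le (S n) v
  have h3 := mul_le_mul_of_nonneg_right hn.le (sq_nonneg ‖v‖)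
  have h4 := mul_le_mul_of_nonneg_left (hcoer v) (sub_nonneg.2 hβ.le)
  nlinarith

/-! ### The parameter moves slowly -/

/-- The terminal cost, which is not assumed to be bounded, is bounded by the span condition. -/
theorem TerminalCostInSpan.exists_bound (hs : M.TerminalCostInSpan) (hM : M.IsRegular) :
    ∃ B : ℝ, 0 ≤ B ∧ ∀ x, |M.cs x| ≤ B := by
  obtain ⟨b, hb⟩ := hM.bounded_psi
  obtain ⟨w, hw⟩ := hs.exists_eq
  refine ⟨1 + d * (‖w‖ * |b|), by positivity, fun x => ?_⟩
  rw [hw]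
  refine (abs_add_le _ _).trans (add_le_add (by simp) ?_)
  exact (abs_dotProduct_le_norm _ _).trans (mul_le_mul_of_nonneg_left
    (mul_le_mul_of_nonneg_left ((hb x).trans (le_abs_self b)) (norm_nonneg _)) (Nat.cast_nonneg _))

theorem exists_norm_tempDiff_smul_le (hM : M.IsRegular) (hs : M.TerminalCostInSpan) (R : ℝ) :
    ∃ C : ℝ, ∀ θ x y, ‖θ‖ ≤ R → ‖M.tempDiff θ x y • M.ψ x‖ ≤ C := by
  obtain ⟨b, hb⟩ := hM.bounded_psi
  obtain ⟨Bc, hBc⟩ := hM.bounded_c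
  obtain ⟨Bs, hBs0, hBs⟩ := hs.exists_bound hM
  refine ⟨(Bc + M.β * (Bs + d * (R * b)) + d * (R * b)) * b, fun θ x y hθ => ?_⟩
  have hR : 0 ≤ R := (norm_nonneg _).trans hθ
  have hb0 : 0 ≤ b := (norm_nonneg _).trans (hb x)
  have hQ : ∀ z, |M.Q θ z| ≤ d * (R * b) := fun z =>
    (abs_dotProduct_le_norm _ _).trans (mul_le_mul_of_nonneg_left
      (mul_le_mul hθ (hb z) (norm_nonneg _) hR) (Nat.cast_nonneg _))
  have hQ0 : 0 ≤ d * (R * b) := by positivity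
  have hmin : |min (M.cs y) (M.Q θ y)| ≤ Bs + d * (R * b) := by
    rcases min_choice (M.cs y) (M.Q θ y) with h | h <;> rw [h]
    · linarith [hBs y]
    · linarith [hQ y]
  have htd : |M.tempDiff θ x y| ≤ Bc + M.β * (Bs + d * (R * b)) + d * (R * b) := by
    unfold tempDiff
    refine (abs_sub _ _).trans (add_le_add ((abs_add_le _ _).trans (add_le_add (hBc x) ?_)) (hQ x))
    rw [abs_mul, abs_of_pos hM.beta_pos]
    exact mul_le_mul_of_nonneg_left hmin hM.beta_pos.le
  rw [norm_smul, Real.norm_eq_abs]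
  exact mul_le_mul htd (hb x) (norm_nonneg _) ((abs_nonneg _).trans htd)

/-- The increments of a bounded parameter sequence are eventually of order `αₙ`, because the matrix
gains are bounded by coercivity, and `∑ γₙ αₙ < ∞`. -/
theorem ae_summable_dist_zapTheta (hM : M.IsRegular) {π : Measure M.S}
    (hergodic : M.UniformlyErgodic π) (hfull : IsUnit (M.covariance π))
    (hs : M.TerminalCostInSpan)
    {Ω : Type*} [MeasurableSpace Ω] {Pr : Measure Ω}
    [IsProbabilityMeasure Pr] {X : ℕ → Ω → M.S} {hX : ∀ n, Measurable (X n)}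
    (hchain : M.IsMarkovChain Pr X hX) {ϱ : ℝ} (hϱ : 1 / 2 < ϱ) (hϱ' : ϱ < 1)
    (θ₀ : Fin d → ℝ) (A₀ : Matrix (Fin d) (Fin d) ℝ)
    (hbdd : ∀ᵐ ω ∂Pr, ∃ B : ℝ, ∀ n, 1 ≤ n → ‖M.zapTheta ϱ θ₀ A₀ X n ω‖ ≤ B) :
    ∀ᵐ ω ∂Pr, Summable fun k : ℕ => gammaStep ϱ (k + 1) *
      dist (M.zapTheta ϱ θ₀ A₀ X (k + 1) ω) (M.zapTheta ϱ θ₀ A₀ X k ω) := by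
  obtain ⟨κ, hκ, hco⟩ := ae_exists_zapA_coercive hM hergodic hfull hchain hϱ hϱ' θ₀ A₀
  filter_upwards [hco, hbdd] with ω hω ⟨R, hR⟩
  obtain ⟨C, hC⟩ := exists_norm_tempDiff_smul_le hM hs R
  refine Summable.of_norm_bounded_eventually_nat
    ((summable_gammaStep_mul_alphaStep (by linarith : 0 < ϱ)).mul_right (d / κ * C)) ?_
  filter_upwards [(tendsto_add_atTop_nat 1).eventually hω, eventually_ge_atTop 1] with k hk hk1
  have hα : 0 ≤ alphaStep (k + 1) := by unfold alphaStep; positivity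
  rw [norm_mul, Real.norm_of_nonneg (gammaStep_nonneg ϱ _), Real.norm_of_nonneg dist_nonneg,
    mul_assoc, dist_eq_norm, zapTheta_succ, sub_sub_cancel_left, norm_neg, norm_smul,
    Real.norm_of_nonneg hα]
  refine mul_le_mul_of_nonneg_left (mul_le_mul_of_nonneg_left ?_ hα) (gammaStep_nonneg ϱ _)
  exact (norm_pinv_mulVec_le hκ hk _).trans
    (mul_le_mul_of_nonneg_left (hC _ _ _ (hR k hk1)) (by positivity))

/-! ### The error sequences -/

/-- Real noise that depends on the parameter only through the indicator `I{Q^θ < c_s}` evaluated at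
the next state is ODE-friendly. -/
theorem odeFriendly_of_contInd (hM : M.IsRegular) {π : Measure M.S}
    (hergodic : M.UniformlyErgodic π) (hdensity : M.HasBoundedLikelihoodRatio)
    (hs : M.TerminalCostInSpan) {Ω : Type*} [MeasurableSpace Ω] {Pr : Measure Ω}
    [IsProbabilityMeasure Pr] {X : ℕ → Ω → M.S} {hX : ∀ n, Measurable (X n)}
    (hchain : M.IsMarkovChain Pr X hX) {γ : ℕ → ℝ} (hγ : ∀ n, 0 ≤ γ n)
    {θ : ℕ → Ω → Fin d → ℝ} (hθ : ∀ n, Measurable[chainFiltration X hX n] (θ n))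
    (hsum : ∀ᵐ ω ∂Pr, Summable fun k : ℕ => γ (k + 1) * dist (θ (k + 1) ω) (θ k ω))
    {a r : M.S → M.S → ℝ} (ha : Measurable (Function.uncurry a))
    (hr : Measurable (Function.uncurry r)) {A R : ℝ} (hA : ∀ x y, |a x y| ≤ A)
    (hR : ∀ x y, |r x y| ≤ R) {E : ℕ → Ω → ℝ}
    (hE : ∀ n ω, E (n + 1) ω =
      a (X n ω) (X (n + 1) ω) + r (X n ω) (X (n + 1) ω) * M.contInd (θ n ω) (X (n + 1) ω)
        - ∫ p, (a p.1 p.2 + r p.1 p.2 * M.contInd (θ n ω) p.2) ∂(π ⊗ₘ M.P)) :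
    ODEFriendly Pr (chainFiltration X hX) γ E := by
  have hP := hM.markov
  have hπ := hergodic.prob
  obtain ⟨D, ρ, hgeo⟩ := hergodic.exists_geomErgodic
  obtain ⟨b, hb⟩ := hM.bounded_psi
  obtain ⟨K, hK⟩ := hdensity.exists_lipschitz hs hM.measurable_psi hM.measurable_cs hP hb
  have hI := measurable_contInd hM.measurable_psi hM.measurable_cs
  have hI1 : ∀ θ y, |M.contInd θ y| ≤ 1 := fun θ y => by
    rw [abs_of_nonneg (M.contInd_nonneg θ y)]; exact M.contInd_le_one θ y
  have hrI : ∀ θ x y, |r x y * M.contInd θ y| ≤ R := fun θ x y => by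
    rw [abs_mul]
    exact (mul_le_of_le_one_right (abs_nonneg _) (hI1 θ y)).trans (hR x y)
  have hB : ∀ θ x y, |a x y + r x y * M.contInd θ y| ≤ A + R := fun θ x y =>
    (abs_add_le _ _).trans (add_le_add (hA x y) (hrI θ x y))
  have hIθ : ∀ θ, Measurable (M.contInd θ) := fun θ => hI.comp measurable_prodMk_left
  have ham : ∀ x, Measurable (a x) := fun x => ha.comp measurable_prodMk_left
  have hrm : ∀ x, Measurable (r x) := fun x => hr.comp measurable_prodMk_left
  refine hchain.markovRel.odeFriendly (π := π) hgeo
    (h := fun θ x y => a x y + r x y * M.contInd θ y) (B := A + R) (K := R * K) ?_ hB ?_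
    hθ hγ hsum hE
  · have e2 : Measurable fun q : ((Fin d → ℝ) × M.S) × M.S => (q.1.2, q.2) :=
      (measurable_snd.comp measurable_fst).prodMk measurable_snd
    exact (ha.comp e2).add ((hr.comp e2).mul (hI.comp
      ((measurable_fst.comp measurable_fst).prodMk measurable_snd)))
  · intro θ θ' x
    have hR0 : 0 ≤ R := (abs_nonneg _).trans (hR x x)
    have hi : ∀ θ, Integrable (fun y => a x y + r x y * M.contInd θ y) (M.P x) := fun θ =>
      integrable_of_forall_abs_le ((ham x).add ((hrm x).mul (hIθ θ))) (hB θ x)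
    have hdi : Integrable (fun y => |M.contInd θ y - M.contInd θ' y|) (M.P x) :=
      (integrable_of_forall_abs_le (hIθ θ) (hI1 θ) |>.sub
        (integrable_of_forall_abs_le (hIθ θ') (hI1 θ'))).abs
    rw [← integral_sub (hi θ) (hi θ')]
    calc |∫ y, (a x y + r x y * M.contInd θ y - (a x y + r x y * M.contInd θ' y)) ∂M.P x|
        ≤ ∫ y, |a x y + r x y * M.contInd θ y - (a x y + r x y * M.contInd θ' y)| ∂M.P x :=
          abs_integral_le_integral_abs
      _ ≤ ∫ y, R * |M.contInd θ y - M.contInd θ' y| ∂M.P x := by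
          refine integral_mono ((hi θ).sub (hi θ')).abs (hdi.const_mul R) fun y => ?_
          have : a x y + r x y * M.contInd θ y - (a x y + r x y * M.contInd θ' y) =
              r x y * (M.contInd θ y - M.contInd θ' y) := by ring
          simp only [this, abs_mul]
          exact mul_le_mul_of_nonneg_right (hR x y) (abs_nonneg _)
      _ = R * ∫ y, |M.contInd θ y - M.contInd θ' y| ∂M.P x := integral_const_mul _ _
      _ ≤ R * (K * ‖θ - θ'‖) := mul_le_mul_of_nonneg_left (hK θ θ' x) hR0
      _ = R * K * dist θ θ' := by rw [dist_eq_norm]; ring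

theorem odeFriendly_errA (hM : M.IsRegular) {π : Measure M.S}
    (hergodic : M.UniformlyErgodic π) (hdensity : M.HasBoundedLikelihoodRatio)
    (hs : M.TerminalCostInSpan) {Ω : Type*} [MeasurableSpace Ω] {Pr : Measure Ω}
    [IsProbabilityMeasure Pr] {X : ℕ → Ω → M.S} {hX : ∀ n, Measurable (X n)}
    (hchain : M.IsMarkovChain Pr X hX) {γ : ℕ → ℝ} (hγ : ∀ n, 0 ≤ γ n)
    {θ : ℕ → Ω → Fin d → ℝ} (hθ : ∀ n, Measurable[chainFiltration X hX n] (θ n))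
    (hsum : ∀ᵐ ω ∂Pr, Summable fun k : ℕ => γ (k + 1) * dist (θ (k + 1) ω) (θ k ω)) :
    ODEFriendly Pr (chainFiltration X hX) γ (M.errA π X θ) := by
  obtain ⟨b, hb⟩ := hM.bounded_psi
  have hβ := hM.beta_pos
  refine ODEFriendly.of_components hγ fun i => ODEFriendly.of_components hγ fun j => ?_
  refine odeFriendly_of_contInd hM hergodic hdensity hs hchain hγ hθ hsum
    (a := fun x _ => -(M.ψ x i * M.ψ x j)) (r := fun x y => M.β * M.ψ x i * M.ψ y j)
    (A := b * b) (R := M.β * (b * b)) ?_ ?_ ?_ ?_ ?_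
  · exact (((measurable_psi_apply hM i).mul (measurable_psi_apply hM j)).comp measurable_fst).neg
  · exact (((measurable_psi_apply hM i).comp measurable_fst).const_mul _).mul
      ((measurable_psi_apply hM j).comp measurable_snd)
  · exact fun x _ => by rw [abs_neg]; exact abs_psi_mul_psi_le hb x i j
  · intro x y
    rw [mul_assoc, abs_mul, abs_mul, abs_of_pos hβ]
    exact mul_le_mul_of_nonneg_left (mul_le_mul (abs_psi_apply_le hb x i)
      (abs_psi_apply_le hb y j) (abs_nonneg _) ((abs_nonneg _).trans (abs_psi_apply_le hb x i)))
      hβ.le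
  · intro n ω
    simp only [← sampleA_apply]
    rfl

/-- The two steady-state means in the parameter recursion form the mean of one function of a
transition, which is the form required for the noise decomposition. -/
theorem meanCs_add_bStar (hM : M.IsRegular) {π : Measure M.S} [IsProbabilityMeasure π]
    (hs : M.TerminalCostInSpan) (θ : Fin d → ℝ) (i : Fin d) :
    M.bStar π i + M.β * M.meanCs π θ i =
      ∫ p, (M.c p.1 + M.β * (M.stopInd θ p.2 * M.cs p.2)) * M.ψ p.1 i ∂(π ⊗ₘ M.P) := by
  have hP := hM.markov
  obtain ⟨b, hb⟩ := hM.bounded_psi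
  obtain ⟨Bc, hBc⟩ := hM.bounded_c
  obtain ⟨Bs, hBs0, hBs⟩ := hs.exists_bound hM
  have hm1 : Measurable fun x => M.ψ x i * M.c x := (measurable_psi_apply hM i).mul hM.measurable_c
  have h1 : ∫ p, M.ψ p.1 i * M.c p.1 ∂(π ⊗ₘ M.P) = M.bStar π i := by
    have := integral_map (μ := π ⊗ₘ M.P) measurable_fst.aemeasurable
      (f := fun x => M.ψ x i * M.c x) hm1.aestronglyMeasurable
    rw [← this]
    change ∫ x, M.ψ x i * M.c x ∂(π ⊗ₘ M.P).fst = _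
    rw [Measure.fst_compProd]
    rfl
  have hind : Measurable (M.stopInd θ) := by
    have : M.stopInd θ = fun x => 1 - M.contInd θ x := funext fun x => M.stopInd_eq θ x
    rw [this]
    exact ((measurable_contInd hM.measurable_psi hM.measurable_cs).comp
      measurable_prodMk_left).const_sub 1
  have hind_le : ∀ y, |M.stopInd θ y| ≤ 1 := fun y => by
    unfold stopInd; split_ifs <;> simp
  have hi1 : Integrable (fun p : M.S × M.S => M.ψ p.1 i * M.c p.1) (π ⊗ₘ M.P) :=
    integrable_of_forall_abs_le (hm1.comp measurable_fst) (B := b * Bc) fun p => by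
      rw [abs_mul]
      exact mul_le_mul (abs_psi_apply_le hb _ i) (hBc _) (abs_nonneg _)
        ((abs_nonneg _).trans (abs_psi_apply_le hb p.1 i))
  have hi2 : Integrable (fun p : M.S × M.S => M.ψ p.1 i * (M.stopInd θ p.2 * M.cs p.2))
      (π ⊗ₘ M.P) :=
    integrable_of_forall_abs_le (((measurable_psi_apply hM i).comp measurable_fst).mul
      ((hind.mul hM.measurable_cs).comp measurable_snd)) (B := b * (1 * Bs)) fun p => by
      rw [abs_mul, abs_mul]
      exact mul_le_mul (abs_psi_apply_le hb _ i) (mul_le_mul (hind_le _) (hBs _) (abs_nonneg _)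
        zero_le_one) (by positivity) ((abs_nonneg _).trans (abs_psi_apply_le hb p.1 i))
  rw [← h1, meanCs, ← integral_const_mul, ← integral_add hi1 (hi2.const_mul _)]
  congr 1
  ext p
  ring

/-- As `c_s` is bounded by the span condition and `I{c_s ≤ Q^θ} = 1 - I{Q^θ < c_s}`, each component
of `𝓔^θ` is noise of the form treated in `odeFriendly_of_contInd`. -/
theorem odeFriendly_errTheta (hM : M.IsRegular) {π : Measure M.S}
    (hergodic : M.UniformlyErgodic π) (hdensity : M.HasBoundedLikelihoodRatio)
    (hs : M.TerminalCostInSpan) {Ω : Type*} [MeasurableSpace Ω] {Pr : Measure Ω}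
    [IsProbabilityMeasure Pr] {X : ℕ → Ω → M.S} {hX : ∀ n, Measurable (X n)}
    (hchain : M.IsMarkovChain Pr X hX) {γ : ℕ → ℝ} (hγ : ∀ n, 0 ≤ γ n)
    {θ : ℕ → Ω → Fin d → ℝ} (hθ : ∀ n, Measurable[chainFiltration X hX n] (θ n))
    (hsum : ∀ᵐ ω ∂Pr, Summable fun k : ℕ => γ (k + 1) * dist (θ (k + 1) ω) (θ k ω)) :
    ODEFriendly Pr (chainFiltration X hX) γ (M.errTheta π X θ) := by
  have hπ := hergodic.prob
  obtain ⟨b, hb⟩ := hM.bounded_psi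
  obtain ⟨Bc, hBc⟩ := hM.bounded_c
  obtain ⟨Bs, hBs0, hBs⟩ := hs.exists_bound hM
  have hβ := hM.beta_pos
  refine ODEFriendly.of_components hγ fun i => ?_
  have hψ := measurable_psi_apply hM i
  have hψb := fun x => abs_psi_apply_le hb x i
  have hrb : ∀ x y, |M.β * M.cs y * M.ψ x i| ≤ M.β * Bs * b := fun x y => by
    rw [abs_mul, abs_mul, abs_of_pos hβ]
    exact mul_le_mul (mul_le_mul_of_nonneg_left (hBs y) hβ.le) (hψb x) (abs_nonneg _)
      (by positivity)
  have hrm : Measurable fun p : M.S × M.S => M.β * M.cs p.2 * M.ψ p.1 i :=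
    ((hM.measurable_cs.comp measurable_snd).const_mul _).mul (hψ.comp measurable_fst)
  have hform : ∀ θ x y, (M.c x + M.β * (M.stopInd θ y * M.cs y)) * M.ψ x i =
      M.c x * M.ψ x i + M.β * M.cs y * M.ψ x i + -(M.β * M.cs y * M.ψ x i) * M.contInd θ y :=
    fun θ x y => by rw [stopInd_eq]; ring
  refine odeFriendly_of_contInd hM hergodic hdensity hs hchain hγ hθ hsum
    (a := fun x y => M.c x * M.ψ x i + M.β * M.cs y * M.ψ x i)
    (r := fun x y => -(M.β * M.cs y * M.ψ x i))
    (A := Bc * b + M.β * Bs * b) (R := M.β * Bs * b) ?_ hrm.neg ?_ ?_ ?_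
  · exact ((hM.measurable_c.mul hψ).comp measurable_fst).add hrm
  · intro x y
    refine (abs_add_le _ _).trans (add_le_add ?_ (hrb x y))
    rw [abs_mul]
    exact mul_le_mul (hBc x) (hψb x) (abs_nonneg _) ((abs_nonneg _).trans (hBc x))
  · exact fun x y => by rw [abs_neg]; exact hrb x y
  · intro n ω
    simp only [← hform]
    rw [← meanCs_add_bStar hM hs]
    simp only [errTheta, Pi.sub_apply, Pi.smul_apply, smul_eq_mul]
    ring

/-- The driving term of the parameter recursion, split into its mean and the errors. -/
theorem mean_add_err_eq (M : StoppingProblem m d) (π : Measure M.S) {Ω : Type*} (X : ℕ → Ω → M.S)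
    (θ : ℕ → Ω → Fin d → ℝ) (n : ℕ) (ω : Ω) :
    M.meanA π (θ n ω) *ᵥ θ n ω + M.β • M.meanCs π (θ n ω) + M.bStar π
      + M.errA π X θ (n + 1) ω *ᵥ θ n ω + M.errTheta π X θ (n + 1) ω =
    M.tempDiff (θ n ω) (X n ω) (X (n + 1) ω) • M.ψ (X n ω) := by
  have hmin : min (M.cs (X (n + 1) ω)) (M.Q (θ n ω) (X (n + 1) ω)) =
      M.contInd (θ n ω) (X (n + 1) ω) * M.Q (θ n ω) (X (n + 1) ω) +
      M.stopInd (θ n ω) (X (n + 1) ω) * M.cs (X (n + 1) ω) := by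
    unfold contInd stopInd
    rcases lt_or_ge (M.Q (θ n ω) (X (n + 1) ω)) (M.cs (X (n + 1) ω)) with h | h
    · rw [if_pos h, if_neg (not_le.2 h), min_eq_right h.le]; ring
    · rw [if_neg (not_lt.2 h), if_pos h, min_eq_left h]; ring
  have hA : M.sampleA (θ n ω) (X n ω) (X (n + 1) ω) *ᵥ θ n ω =
      (M.β * M.contInd (θ n ω) (X (n + 1) ω) * M.Q (θ n ω) (X (n + 1) ω) - M.Q (θ n ω) (X n ω))
        • M.ψ (X n ω) := by
    rw [sampleA, vecMulVec_mulVec, sub_dotProduct, smul_dotProduct, dotProduct_comm,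
      dotProduct_comm (M.ψ (X n ω))]
    ext i
    simp [Q, mul_comm]
  simp only [errA, errTheta, sub_mulVec, hA, tempDiff, hmin]
  ext i
  simp only [Pi.add_apply, Pi.sub_apply, Pi.smul_apply, smul_eq_mul]
  ring

end StoppingProblem

end

theorem mainTheorem6 {m d : ℕ} (M : StoppingProblem m d) (hM : M.IsRegular)
    (π : Measure M.S) (hergodic : M.UniformlyErgodic π)
    (hfull : IsUnit (M.covariance π))
    (hdensity : M.HasBoundedLikelihoodRatio) (hspan : M.TerminalCostInSpan)
    {Ω : Type*} [MeasurableSpace Ω] (Pr : Measure Ω) [IsProbabilityMeasure Pr]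
    (X : ℕ → Ω → M.S) (hX : ∀ n, Measurable (X n)) (hchain : M.IsMarkovChain Pr X hX)
    (ϱ : ℝ) (hϱ : 1 / 2 < ϱ) (hϱ' : ϱ < 1)
    (θ₀ : Fin d → ℝ) (A₀ : Matrix (Fin d) (Fin d) ℝ)
    (hA₀ : ∀ v : Fin d → ℝ, v ≠ 0 → v ⬝ᵥ (A₀ *ᵥ v) < 0)
    (θ : ℕ → Ω → Fin d → ℝ) (hθ : θ = M.zapTheta ϱ θ₀ A₀ X)
    (Ahat : ℕ → Ω → Matrix (Fin d) (Fin d) ℝ) (hAhat : Ahat = M.zapA ϱ θ₀ A₀ X)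
    (hbdd : ∀ᵐ ω ∂Pr, ∃ B : ℝ, ∀ n, 1 ≤ n → ‖θ n ω‖ ≤ B) :
    (∀ n ω, θ (n + 1) ω = θ n ω - StoppingProblem.alphaStep (n + 1) •
      (pinv (Ahat (n + 1) ω) *ᵥ
        (M.meanA π (θ n ω) *ᵥ θ n ω + M.β • M.meanCs π (θ n ω) + M.bStar π
          + M.errA π X θ (n + 1) ω *ᵥ θ n ω + M.errTheta π X θ (n + 1) ω))) ∧
    (∀ n ω, Ahat (n + 1) ω = Ahat n ω + StoppingProblem.gammaStep ϱ (n + 1) •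
      (M.meanA π (θ n ω) - Ahat n ω + M.errA π X θ (n + 1) ω)) ∧
    ODEFriendly Pr (StoppingProblem.chainFiltration X hX) (StoppingProblem.gammaStep ϱ)
      (M.errTheta π X θ) ∧
    ODEFriendly Pr (StoppingProblem.chainFiltration X hX) (StoppingProblem.gammaStep ϱ)
      (M.errA π X θ) := by
  subst hθ hAhat
  have hθm : ∀ n, Measurable[StoppingProblem.chainFiltration X hX n] (M.zapTheta ϱ θ₀ A₀ X n) :=
    fun n => (StoppingProblem.measurable_zap hM hchain.markovRel.adapted ϱ θ₀ A₀ n).1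
  have hsum := StoppingProblem.ae_summable_dist_zapTheta hM hergodic hfull hspan hchain hϱ hϱ'
    θ₀ A₀ hbdd
  refine ⟨fun n ω => ?_, fun n ω => ?_, ?_, ?_⟩
  · rw [StoppingProblem.mean_add_err_eq, StoppingProblem.zapTheta_succ]
  · rw [StoppingProblem.zapA_succ]
    congr 2
    simp only [StoppingProblem.errA]
    abel
  · exact StoppingProblem.odeFriendly_errTheta hM hergodic hdensity hspan hchain
      (StoppingProblem.gammaStep_nonneg ϱ) hθm hsum
  · exact StoppingProblem.odeFriendly_errA hM hergodic hdensity hspan hchain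
      (StoppingProblem.gammaStep_nonneg ϱ) hθm hsum
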